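/- Let $n\ge 1$, let $x_1,\dots,x_n\in[0,1]^p$ be the (fixed) design points, and let $y_1,\dots,y_n$ be independent with $y_i\sim\mathcal N(m^0(x_i),\sigma^2)$, $\sigma>0$, where $m^0(z)=\sum_{j\in\mathcal J_*}m_j^0(z_j)$ for a set $\mathcal J_*\subset\{1,\dots,p\}$ and functions $m_j^0:\mathbb R\to\mathbb R$, $j=1,\dots,p$, such that $m_j^0$ is $L$-Lipschitz for $j\in\mathcal J_*$ and $\sum_{i=1}^n m_j^0(x_{i,j})=0$ for all $j$. Write $\|g\|_n^2=\frac1n\sum_{i=1}^n g(x_i)^2$. Let $D=\lfloor n^{1/3}\rfloor$, $d=pD$, $I_1=[0,\frac1D]$, $I_k=(\frac{k-1}D,\frac kD]$ for $2\le k\le D$, $n_{j,k}=|\{i:x_{i,j}\in I_k\}|$ and $\hat\pi_{j,k}=\frac1n|\{i:x_{i,j}\in\bigcup_{k'\ge k}I_{k'}\}|$. For $\theta=(\theta_{j,k})\in\mathbb R^{d}$ put $m_\theta(z)=\sum_{j,k}\theta_{j,k}\mathbf 1_{I_k}(z_j)$. Fix $A>0$ and let $\hat w_{j,k}=\sqrt{2\sigma^2(A+\log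 d)\,\hat\pi_{j,k}/n}$. Let $\hat\theta$ be any minimizer over $\mathbb R^d$ of $$\frac1n\sum_{i=1}^n\frac12\big(y_i-m_\theta(x_i)\big)^2+\sum_{j=1}^p\Big(\sum_{k=2}^D\hat w_{j,k}|\theta_{j,k}-\theta_{j,k-1}|+\delta_j(\theta_{j,\bullet})\Big),$$ where $\delta_j(u)=0$ if $\sum_k n_{j,k}u_k=0$ and $\delta_j(u)=\infty$ otherwise. For $\theta\in\mathbb R^d$ let $J_j(\theta)=\{k\in\{2,\dots,D\}:\theta_{j,k}\ne\theta_{j,k-1}\}$, $J(\theta)=[J_1(\theta),\dots,J_p(\theta)]$ and $|J(\theta)|=\sum_j|J_j(\theta)|$. For $K=[K_1,\dots,K_p]$ with $K_j\subset\{2,\dots,D\}$, let $\mathscr C(K)$ be the set of $u\in\mathbb R^d$ with $\sum_k n_{j,k}u_{j,k}=0$ for all $j$ and $$\sum_{j}\sum_{k\in\{2,\dots,D\}\setminus K_j}\hat w_{j,k}|u_{j,k}-u_{j,k-1}|\le 2\sum_{j}\sum_{k\in K_j}\hat w_{j,k}|u_{j,k}-u_{j,k-1}|,$$ and let $$\kappa(K)=\inf\Big\{\frac{(\sum_{i=1}^n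 m_u(x_i)^2)^{1/2}}{\sqrt n\,\|u_K\|_2}:u\in\mathscr C(K),\ u_K\ne0\Big\}\in[0,\infty],\qquad \|u_K\|_2^2=\sum_j\sum_{k\in K_j}u_{j,k}^2,$$ with $\inf\varnothing=\infty$ and $1/\infty=0$. Let $\theta^*_{j,k}=\sum_i m_j^0(x_{i,j})\mathbf 1_{I_k}(x_{i,j})/n_{j,k}$ for $j\in\mathcal J_*$ (with the value $0$ if $n_{j,k}=0$) and $\theta^*_{j,k}=0$ for $j\notin\mathcal J_*$. Assume the restricted eigenvalue condition: $\kappa(K)>0$ for every $K$ with $\sum_j|K_j|\le|J(\theta^*)|$. Then, with probability at least $1-2e^{-A}$, every such $\hat\theta$ satisfies $$\|m_{\hat\theta}-m^0\|_n^2\le\Big(3L^2|\mathcal J_*|+\frac{5120\,M_n\sigma^2\big(A+\log(p\,n^{1/3}M_n)\big)}{\kappa^2(J(\theta^*))}\Big)\frac{|\mathcal J_*|}{n^{2/3}},$$ where $M_n=\max\{1,\max_{j,i}|m_j^0(x_{i,j})|\}$. -/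

import Mathlib

open MeasureTheory ProbabilityTheory
open scoped NNReal ENNReal

noncomputable section

namespace Binarsity

/-- The number of bins per feature: the integer part of `n ^ (1/3)`. -/
def numBins (n : ℕ) : ℕ := ⌊(n : ℝ) ^ (1 / 3 : ℝ)⌋₊

/-- The `D` equal-width bins of `[0, 1]`, indexed from `0`: the bin of index `0` is `[0, 1/D]`, and
the bin of index `k > 0` is `(k/D, (k+1)/D]`. -/
def bin (D : ℕ) (k : Fin D) : Set ℝ :=
  if k.val = 0 then Set.Icc 0 (1 / (D : ℝ)) else Set.Ioc ((k.val : ℝ) / D) ((k.val + 1 : ℝ) / D)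

/-- The entry `1` or `0` of the one-hot encoding of the value `z` in bin `k`. -/
def oneHot (D : ℕ) (k : Fin D) (z : ℝ) : ℝ := (bin D k).indicator (fun _ => (1 : ℝ)) z

/-- The piecewise constant additive function `m_θ(z) = ⟨θ, z^B⟩`, where `z^B` is the binarized
version of `z`. -/
def mFun {p D : ℕ} (θ : Fin p → Fin D → ℝ) (z : Fin p → ℝ) : ℝ :=
  ∑ j, ∑ k, θ j k * oneHot D k (z j)

/-- The empirical squared norm `‖g‖_n² = (1/n) ∑ i, g (x i)²`. -/
def empNormSq {n p : ℕ} (x : Fin n → Fin p → ℝ) (g : (Fin p → ℝ) → ℝ) : ℝ :=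
  1 / (n : ℝ) * ∑ i, g (x i) ^ 2

open Classical in
/-- `n_{j,k}`: the number of samples whose `j`-th feature falls in bin `k`. -/
def binCount {n p : ℕ} (D : ℕ) (x : Fin n → Fin p → ℝ) (j : Fin p) (k : Fin D) : ℕ :=
  (Finset.univ.filter fun i => x i j ∈ bin D k).card

open Classical in
/-- The proportion of samples whose `j`-th feature falls in bin `k` or in a bin further right. -/
def tailProp {n p : ℕ} (D : ℕ) (x : Fin n → Fin p → ℝ) (j : Fin p) (k : Fin D) : ℝ :=
  ((Finset.univ.filter fun i => x i j ∈ ⋃ k' ∈ Set.Ici k, bin D k').card : ℝ) / n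

/-- The data-driven weights `√(2 σ² (A + log d) / n · π̂_{j,k})`, with `d = p D` the total number of
coefficients. -/
def weight {n p : ℕ} (D : ℕ) (x : Fin n → Fin p → ℝ) (σ A : ℝ) (j : Fin p) (k : Fin D) : ℝ :=
  Real.sqrt (2 * σ ^ 2 * (A + Real.log ((p : ℝ) * D)) / n * tailProp D x j k)

/-- The indices at which a block of coefficients has a predecessor (all except the first one). -/
def jumpIdx (D : ℕ) : Finset (Fin D) := Finset.univ.filter fun k => 0 < k.val

/-- The predecessor of an index (only used at indices in `jumpIdx D`). -/
def prev {D : ℕ} (k : Fin D) : Fin D := ⟨k.val - 1, lt_of_le_of_lt (Nat.sub_le _ _) k.isLt⟩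

/-- The weighted total variation of the block `u`, restricted to the jumps at indices in `S`. -/
def tvOn {D : ℕ} (w : Fin D → ℝ) (u : Fin D → ℝ) (S : Finset (Fin D)) : ℝ :=
  ∑ k ∈ S, w k * |u k - u (prev k)|

/-- The linear constraint `n_jᵀ u = 0` on the `j`-th block. -/
def BlockCentered {n p D : ℕ} (x : Fin n → Fin p → ℝ) (j : Fin p) (u : Fin D → ℝ) : Prop :=
  ∑ k, (binCount D x j k : ℝ) * u k = 0

open Classical in
/-- The `{0, ∞}`-valued indicator `δ_j` of the linear constraint on the `j`-th block. -/
def blockIndicator {n p D : ℕ} (x : Fin n → Fin p → ℝ) (j : Fin p) (u : Fin D → ℝ) : EReal :=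
  if BlockCentered x j u then 0 else ⊤

/-- The binarsity penalization, with weights `w`. -/
def bina {n p D : ℕ} (x : Fin n → Fin p → ℝ) (w : Fin p → Fin D → ℝ)
    (θ : Fin p → Fin D → ℝ) : EReal :=
  ∑ j, (((tvOn (w j) (θ j) (jumpIdx D) : ℝ) : EReal) + blockIndicator x j (θ j))

/-- The least-squares goodness-of-fit `(1/n) ∑ i, (1/2) (y i - m_θ(x i))²`. -/
def leastSquares {n p D : ℕ} (x : Fin n → Fin p → ℝ) (y : Fin n → ℝ)
    (θ : Fin p → Fin D → ℝ) : ℝ :=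
  1 / (n : ℝ) * ∑ i, (1 / 2 : ℝ) * (y i - mFun θ (x i)) ^ 2

/-- `θ` is a minimizer of the least-squares criterion penalized by binarsity. -/
def IsBinarsityEstimator {n p D : ℕ} (x : Fin n → Fin p → ℝ) (w : Fin p → Fin D → ℝ)
    (y : Fin n → ℝ) (θ : Fin p → Fin D → ℝ) : Prop :=
  ∀ θ' : Fin p → Fin D → ℝ,
    ((leastSquares x y θ : ℝ) : EReal) + bina x w θ
      ≤ ((leastSquares x y θ' : ℝ) : EReal) + bina x w θ'

open Classical in
/-- `J_j(θ)`: the set of jumps of the `j`-th block of `θ`. -/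
def jumpSet {p D : ℕ} (θ : Fin p → Fin D → ℝ) (j : Fin p) : Finset (Fin D) :=
  (jumpIdx D).filter fun k => θ j k ≠ θ j (prev k)

/-- The cone of those vectors, with blocks satisfying the linear constraints, whose weighted total
variation outside `K` is at most twice the one on `K`. -/
def cone {n p D : ℕ} (x : Fin n → Fin p → ℝ) (w : Fin p → Fin D → ℝ)
    (K : Fin p → Finset (Fin D)) : Set (Fin p → Fin D → ℝ) :=
  {u | (∀ j, BlockCentered x j (u j)) ∧
    ∑ j, tvOn (w j) (u j) (jumpIdx D \ K j) ≤ 2 * ∑ j, tvOn (w j) (u j) (K j)}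

/-- The Euclidean norm of the coordinates of `u` in `K`. -/
def restrNorm {p D : ℕ} (u : Fin p → Fin D → ℝ) (K : Fin p → Finset (Fin D)) : ℝ :=
  Real.sqrt (∑ j, ∑ k ∈ K j, u j k ^ 2)

/-- The restricted eigenvalue `κ(K)`: the infimum of `‖X^B u‖₂ / (√n ‖u_K‖₂)` over the `u` in the
cone for which the ratio is a number (`u_K ≠ 0`). The infimum of the empty set is `∞`. -/
def kappa {n p D : ℕ} (x : Fin n → Fin p → ℝ) (w : Fin p → Fin D → ℝ)
    (K : Fin p → Finset (Fin D)) : ℝ≥0∞ :=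
  ⨅ u ∈ {u | u ∈ cone x w K ∧ restrNorm u K ≠ 0},
    ENNReal.ofReal (Real.sqrt (∑ i, mFun u (x i) ^ 2) / (Real.sqrt n * restrNorm u K))

/-- The restricted eigenvalue condition at sparsity level `s`. -/
def RECondition {n p D : ℕ} (x : Fin n → Fin p → ℝ) (w : Fin p → Fin D → ℝ) (s : ℕ) : Prop :=
  ∀ K : Fin p → Finset (Fin D), (∀ j, K j ⊆ jumpIdx D) → ∑ j, (K j).card ≤ s → 0 < kappa x w K

/-- The sparse additive function `z ↦ ∑ j ∈ S, m_j(z_j)`. -/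
def additive {p : ℕ} (S : Finset (Fin p)) (m : Fin p → ℝ → ℝ) (z : Fin p → ℝ) : ℝ :=
  ∑ j ∈ S, m j (z j)

/-- The coefficients `θ*`: on active features the average of the component over each bin, on
inactive features `0` (and `0` on a bin without samples). -/
def thetaStar {n p : ℕ} (D : ℕ) (x : Fin n → Fin p → ℝ) (S : Finset (Fin p))
    (m : Fin p → ℝ → ℝ) (j : Fin p) (k : Fin D) : ℝ :=
  if j ∈ S then (∑ i, m j (x i j) * oneHot D k (x i j)) / (∑ i, oneHot D k (x i j)) else 0

/-- `M_n`: the maximum of `1` and of all the `|m_j(x_{i,j})|`. -/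
def maxComponent {n p : ℕ} (x : Fin n → Fin p → ℝ) (m : Fin p → ℝ → ℝ) : ℝ :=
  max 1 (⨆ (j : Fin p) (i : Fin n), |m j (x i j)|)

end Binarsity

end

namespace Binarsity

/-! The restricted eigenvalue is never applied to the estimation error: the bound follows from a
slow-rate inequality and an upper bound on `kappa`.

By Abel summation the noise acts on a centred block only through the centred right tails of the
bins. These are sub-Gaussian, and the weights dominate all of them with probability `1 - 2 exp (-A)`
(`exists_noise_event`). On that event `slow_rate` compares the estimator with any centred comparator
at the price of four times its weighted total variation.

Testing `kappa` on the centred indicator of a jump bin containing a proportion `f` of the sample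
gives `κ² ≤ f / (1 - f)` for `f < 1`. Hence jump bins are occupied, and `1/κ²` bounds the odds
against each of them. As the proportions in one block sum to at most `1`, either the number of jumps
`s` (beyond the first occupied bin) is at most `7/κ²`, or there is one jump, at a bin holding more
than `7/8` of the sample (`exists_comparator`).

In the first case the comparator is the block of bin averages, made constant up to the first
occupied bin. Its steps are `O(L/D)`, except for restarts from an empty bin, where the average is
`0` by convention; `path_weighted_tv_le` absorbs these. The total variation is then of order `λ L
√(s/D)` with `λ² ≍ V/n` and `V = σ² (A + log d)`, and the inequality of arithmetic and geometric
means splits the price into `L²` and `V s`, both over `n^(2/3)`. In the second case the averages are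
so small in mean square that the comparator `0` suffices. `oracle_inequality` adds the active blocks
up. -/

lemma numBins_le (n : ℕ) : (numBins n : ℝ) ≤ (n : ℝ) ^ (1 / 3 : ℝ) :=
  Nat.floor_le (by positivity)

lemma numBins_pos {n : ℕ} (hn : 0 < n) : 0 < numBins n := by
  have h : (1 : ℝ) ≤ (n : ℝ) ^ (1 / 3 : ℝ) :=
    Real.one_le_rpow (by exact_mod_cast hn) (by norm_num)
  exact Nat.floor_pos.mpr h

lemma rpow_third_le {n : ℕ} (hn : 0 < n) : (n : ℝ) ^ (1 / 3 : ℝ) ≤ 2 * numBins n := by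
  have h := Nat.lt_floor_add_one ((n : ℝ) ^ (1 / 3 : ℝ))
  have h1 : (1 : ℝ) ≤ numBins n := by exact_mod_cast numBins_pos hn
  change _ < (numBins n : ℝ) + 1 at h
  linarith

/-! ### Geometry of the bins. -/

/-- The midpoint of a bin. -/
noncomputable def binMid (D : ℕ) (k : Fin D) : ℝ := ((k.val : ℝ) + 1 / 2) / D

lemma mem_bin_bounds {D : ℕ} {k : Fin D} {z : ℝ} (h : z ∈ bin D k) :
    (k.val : ℝ) ≤ z * D ∧ z * D ≤ k.val + 1 ∧ (k.val ≠ 0 → (k.val : ℝ) < z * D) := by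
  have hD : (0 : ℝ) < D := by exact_mod_cast k.pos
  unfold bin at h
  split_ifs at h with hk
  · obtain ⟨h0, h1⟩ := h
    rw [le_div_iff₀ hD] at h1
    refine ⟨by rw [hk]; simpa using mul_nonneg h0 hD.le, by rw [hk]; simpa using h1,
      fun h => absurd hk h⟩
  · obtain ⟨h0, h1⟩ := h
    rw [le_div_iff₀ hD] at h1
    rw [div_lt_iff₀ hD] at h0
    exact ⟨h0.le, h1, fun _ => h0⟩

lemma bin_unique {D : ℕ} {k l : Fin D} {z : ℝ} (hk : z ∈ bin D k) (hl : z ∈ bin D l) :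
    k = l := by
  obtain ⟨-, h2, h3⟩ := mem_bin_bounds hk
  obtain ⟨-, g2, g3⟩ := mem_bin_bounds hl
  ext
  by_contra hne
  rcases lt_or_gt_of_ne hne with h | h
  · have := g3 (by omega)
    have h' : (k.val : ℝ) + 1 ≤ l.val := by exact_mod_cast h
    linarith
  · have := h3 (by omega)
    have h' : (l.val : ℝ) + 1 ≤ k.val := by exact_mod_cast h
    linarith

lemma exists_bin {D : ℕ} (hD : 0 < D) {z : ℝ} (hz : z ∈ Set.Icc (0 : ℝ) 1) :
    ∃ k, z ∈ bin D k := by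
  have hD' : (0 : ℝ) < D := by exact_mod_cast hD
  have hz0 : 0 ≤ z * D := mul_nonneg hz.1 hD'.le
  have hc : ⌈z * D⌉₊ ≤ D := Nat.ceil_le.mpr (by nlinarith [hz.2])
  by_cases hle : ⌈z * D⌉₊ ≤ 1
  · refine ⟨⟨0, hD⟩, ?_⟩
    have h1 : z * D ≤ 1 := (Nat.le_ceil _).trans (by exact_mod_cast hle)
    simp only [bin, if_true]
    exact ⟨hz.1, by rwa [le_div_iff₀ hD']⟩
  · push Not at hle
    refine ⟨⟨⌈z * D⌉₊ - 1, by omega⟩, ?_⟩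
    have h0 : ¬ (⌈z * D⌉₊ - 1 = 0) := by omega
    simp only [bin, if_neg h0]
    have hcast : ((⌈z * D⌉₊ - 1 : ℕ) : ℝ) = (⌈z * D⌉₊ : ℝ) - 1 := by
      rw [Nat.cast_sub (by omega)]; simp
    rw [hcast]
    refine ⟨?_, ?_⟩
    · rw [div_lt_iff₀ hD']
      linarith [Nat.ceil_lt_add_one hz0]
    · rw [le_div_iff₀ hD']
      linarith [Nat.le_ceil (z * D)]

lemma abs_sub_binMid_le {D : ℕ} {k : Fin D} {z : ℝ} (h : z ∈ bin D k) :
    |z - binMid D k| ≤ 1 / (2 * D) := by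
  have hD : (0 : ℝ) < D := by exact_mod_cast k.pos
  obtain ⟨h1, h2, -⟩ := mem_bin_bounds h
  have e : z - binMid D k = (z * D - (k.val + 1 / 2)) / D := by
    unfold binMid; field_simp
  rw [e, abs_div, abs_of_pos hD, div_le_div_iff₀ hD (by positivity)]
  have : |z * D - (k.val + 1 / 2)| ≤ 1 / 2 := by rw [abs_le]; constructor <;> linarith
  nlinarith

/-! ### Reformulation through the map `b` sending a sample and a feature to a bin. -/

section Index

variable {n p D : ℕ} {x : Fin n → Fin p → ℝ} {b : Fin n → Fin p → Fin D}

lemma mFun_eq (hb : ∀ i j k, x i j ∈ bin D k ↔ b i j = k) (u : Fin p → Fin D → ℝ) (i : Fin n) :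
    mFun u (x i) = ∑ j, u j (b i j) := by
  classical
  unfold mFun
  refine Finset.sum_congr rfl fun j _ => ?_
  rw [Finset.sum_eq_single (b i j)]
  · simp [oneHot, Set.indicator, hb]
  · intro k _ hk
    simp [oneHot, Set.indicator, hb, hk.symm]
  · simp

lemma binCount_eq (hb : ∀ i j k, x i j ∈ bin D k ↔ b i j = k) (j : Fin p) (k : Fin D) :
    binCount D x j k = (Finset.univ.filter fun i => b i j = k).card := by
  classical
  unfold binCount
  congr 1
  ext i
  simp [hb]

lemma tailProp_eq (hb : ∀ i j k, x i j ∈ bin D k ↔ b i j = k) (j : Fin p) (k : Fin D) :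
    tailProp D x j k = (∑ i, if k ≤ b i j then (1 : ℝ) else 0) / n := by
  classical
  unfold tailProp
  rw [Finset.sum_boole]
  congr 3
  ext i
  simp [hb]

lemma blockCentered_iff (hb : ∀ i j k, x i j ∈ bin D k ↔ b i j = k) (j : Fin p) (u : Fin D → ℝ) :
    BlockCentered x j u ↔ ∑ i, u (b i j) = 0 := by
  classical
  unfold BlockCentered
  have : ∑ k, (binCount D x j k : ℝ) * u k = ∑ i, u (b i j) := by
    rw [← Finset.sum_fiberwise (s := Finset.univ) (g := fun i => b i j)]
    refine Finset.sum_congr rfl fun k _ => ?_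
    rw [Finset.sum_congr rfl (g := fun _ => u k), Finset.sum_const, binCount_eq hb, nsmul_eq_mul]
    intro i hi
    rw [(Finset.mem_filter.mp hi).2]
  rw [this]

lemma tailProp_nonneg (x : Fin n → Fin p → ℝ) (j : Fin p) (k : Fin D) : 0 ≤ tailProp D x j k := by
  unfold tailProp; positivity

lemma tailProp_anti (hb : ∀ i j k, x i j ∈ bin D k ↔ b i j = k) (j : Fin p) {k l : Fin D}
    (h : k ≤ l) : tailProp D x j l ≤ tailProp D x j k := by
  rw [tailProp_eq hb, tailProp_eq hb]
  gcongr with i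
  split_ifs with h1 h2
  · rfl
  · exact absurd (h.trans h1) h2
  · norm_num
  · rfl

end Index

/-- Abel summation on one block. -/
lemma sum_jump_eq {D : ℕ} (u : Fin D → ℝ) (l : Fin D) (hD : 0 < D) :
    u l = u ⟨0, hD⟩ + ∑ k ∈ jumpIdx D, (u k - u (prev k)) * if k ≤ l then 1 else 0 := by
  obtain ⟨l, hl⟩ := l
  induction l with
  | zero =>
    rw [Finset.sum_eq_zero, add_zero]
    intro k hk
    have : 0 < k.val := by simpa [jumpIdx] using hk
    rw [if_neg, mul_zero]
    rw [Fin.le_def]; simp; omega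
  | succ l ih =>
    have hl' : l < D := by omega
    have hmem : (⟨l + 1, hl⟩ : Fin D) ∈ jumpIdx D := by simp [jumpIdx]
    have key : ∑ k ∈ jumpIdx D, (u k - u (prev k)) * (if k ≤ ⟨l + 1, hl⟩ then 1 else 0)
        = (∑ k ∈ jumpIdx D, (u k - u (prev k)) * (if k ≤ ⟨l, hl'⟩ then 1 else 0))
          + (u ⟨l + 1, hl⟩ - u ⟨l, hl'⟩) := by
      rw [← sub_eq_iff_eq_add', ← Finset.sum_sub_distrib, Finset.sum_eq_single ⟨l + 1, hl⟩]
      · simp [prev, Fin.le_def]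
      · intro k _ hk
        have : k.val ≠ l + 1 := fun h => hk (Fin.ext h)
        have : (k ≤ (⟨l + 1, hl⟩ : Fin D)) ↔ k ≤ (⟨l, hl'⟩ : Fin D) := by
          simp only [Fin.le_def]; omega
        simp [this]
      · exact fun h => absurd hmem h
    rw [key]
    linarith [ih hl']

/-- Averaging the Abel formula over the sample determines the first coefficient; substituting it
back centres each right-tail indicator. -/
lemma centred_sum_jump_eq {n D : ℕ} (hn : 0 < n) (b : Fin n → Fin D) (u : Fin D → ℝ)
    (hu : ∑ i, u (b i) = 0) (i : Fin n) :
    u (b i) = ∑ k ∈ jumpIdx D, (u k - u (prev k)) *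
      ((if k ≤ b i then 1 else 0) - (∑ i', if k ≤ b i' then (1 : ℝ) else 0) / n) := by
  have hD : 0 < D := (b i).pos
  have hn' : (n : ℝ) ≠ 0 := by positivity
  have h0 : u ⟨0, hD⟩ = - ∑ k ∈ jumpIdx D, (u k - u (prev k)) *
      ((∑ i', if k ≤ b i' then (1 : ℝ) else 0) / n) := by
    have : ∑ i', u (b i') = n * u ⟨0, hD⟩ + ∑ k ∈ jumpIdx D, (u k - u (prev k)) *
        (∑ i', if k ≤ b i' then (1 : ℝ) else 0) := by
      rw [Finset.sum_congr rfl fun i' _ => sum_jump_eq u (b i') hD, Finset.sum_add_distrib,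
        Finset.sum_comm]
      simp only [← Finset.mul_sum, Finset.sum_const, Finset.card_univ, Fintype.card_fin,
        nsmul_eq_mul]
    rw [hu] at this
    have e : ∑ k ∈ jumpIdx D, (u k - u (prev k)) *
      ((∑ i', if k ≤ b i' then (1 : ℝ) else 0) / n) = (∑ k ∈ jumpIdx D, (u k - u (prev k)) *
        (∑ i', if k ≤ b i' then (1 : ℝ) else 0)) / n := by
      rw [Finset.sum_div]; simp only [mul_div_assoc]
    rw [e]
    field_simp
    linarith
  rw [sum_jump_eq u (b i) hD, h0]
  simp only [mul_sub, Finset.sum_sub_distrib]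
  ring

/-! ### The basic inequality with slow rate. -/

section SlowRate

variable {n p D : ℕ} {x : Fin n → Fin p → ℝ} {b : Fin n → Fin p → Fin D}

lemma bina_eq_coe (w : Fin p → Fin D → ℝ) (h : Fin p → Fin D → ℝ)
    (hh : ∀ j, BlockCentered x j (h j)) :
    bina x w h = ((∑ j, tvOn (w j) (h j) (jumpIdx D) : ℝ) : EReal) := by
  unfold bina
  simp only [blockIndicator, hh, if_true, add_zero]
  induction (Finset.univ : Finset (Fin p)) using Finset.induction_on with
  | empty => simp
  | insert j s hj ih => rw [Finset.sum_insert hj, Finset.sum_insert hj, ih, EReal.coe_add]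

/-- The zero vector has finite objective, so a minimizer cannot violate a constraint. Nonnegative
weights keep the other penalty terms away from `⊥`, which would absorb `⊤`. -/
lemma IsBinarsityEstimator.blockCentered {w : Fin p → Fin D → ℝ} {y : Fin n → ℝ}
    {θ : Fin p → Fin D → ℝ} (hw : ∀ j k, 0 ≤ w j k) (hθ : IsBinarsityEstimator x w y θ)
    (j : Fin p) : BlockCentered x j (θ j) := by
  by_contra hj
  have h0 := hθ 0
  rw [bina_eq_coe w 0 (fun j => by simp [BlockCentered]), ← EReal.coe_add] at h0
  have htop : bina x w θ = ⊤ := by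
    unfold bina
    rw [← Finset.add_sum_erase _ _ (Finset.mem_univ j)]
    have hnn : ∀ j', (0 : EReal) ≤
        ((tvOn (w j') (θ j') (jumpIdx D) : ℝ) : EReal) + blockIndicator x j' (θ j') := by
      intro j'
      refine add_nonneg ?_ ?_
      · exact_mod_cast Finset.sum_nonneg fun k _ => mul_nonneg (hw j' k) (abs_nonneg _)
      · unfold blockIndicator; split_ifs <;> simp
    have h1 : ((tvOn (w j) (θ j) (jumpIdx D) : ℝ) : EReal) + blockIndicator x j (θ j) = ⊤ := by
      simp [blockIndicator, hj]
    rw [h1]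
    exact EReal.top_add_of_ne_bot
      (ne_of_gt (lt_of_lt_of_le EReal.bot_lt_zero (Finset.sum_nonneg fun j' _ => hnn j')))
  rw [htop, EReal.coe_add_top] at h0
  exact absurd h0 (not_le.mpr (EReal.coe_lt_top _))

/-- The empirical process indexed by the centred right tails of the bins of a feature. -/
noncomputable def tailNoise (b : Fin n → Fin p → Fin D) (e : Fin n → ℝ) (j : Fin p) (k : Fin D) : ℝ :=
  1 / (n : ℝ) * ∑ i, ((if k ≤ b i j then 1 else 0) -
    (∑ i', if k ≤ b i' j then (1 : ℝ) else 0) / n) * e i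

/-- Duality: Abel summation turns the pairing with the noise into one between increments and tail
noises. -/
lemma abs_noise_le (hn : 0 < n) {w : Fin p → Fin D → ℝ} {e : Fin n → ℝ}
    (he : ∀ j, ∀ k, |tailNoise b e j k| ≤ w j k)
    {u : Fin p → Fin D → ℝ} (hu : ∀ j, ∑ i, u j (b i j) = 0) :
    |1 / (n : ℝ) * ∑ i, e i * ∑ j, u j (b i j)| ≤ ∑ j, tvOn (w j) (u j) (jumpIdx D) := by
  have key : 1 / (n : ℝ) * ∑ i, e i * ∑ j, u j (b i j)
      = ∑ j, ∑ k ∈ jumpIdx D, (u j k - u j (prev k)) * tailNoise b e j k := by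
    have h1 : ∀ i, ∑ j, u j (b i j) = ∑ j, ∑ k ∈ jumpIdx D, (u j k - u j (prev k)) *
      ((if k ≤ b i j then 1 else 0) - (∑ i', if k ≤ b i' j then (1 : ℝ) else 0) / n) :=
      fun i => Finset.sum_congr rfl fun j _ =>
        centred_sum_jump_eq hn (fun i => b i j) (u j) (hu j) i
    simp only [h1, Finset.mul_sum, tailNoise]
    rw [Finset.sum_comm]
    refine Finset.sum_congr rfl fun j _ => ?_
    rw [Finset.sum_comm]
    refine Finset.sum_congr rfl fun k _ => Finset.sum_congr rfl fun i _ => ?_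
    ring
  rw [key]
  refine (Finset.abs_sum_le_sum_abs _ _).trans (Finset.sum_le_sum fun j _ => ?_)
  refine (Finset.abs_sum_le_sum_abs _ _).trans (Finset.sum_le_sum fun k _ => ?_)
  rw [abs_mul, mul_comm]
  exact mul_le_mul_of_nonneg_right (he j k) (abs_nonneg _)

lemma tvOn_sub_le {w : Fin D → ℝ} (hw : ∀ k, 0 ≤ w k) (u v : Fin D → ℝ) (S : Finset (Fin D)) :
    tvOn w (fun k => u k - v k) S ≤ tvOn w u S + tvOn w v S := by
  unfold tvOn
  rw [← Finset.sum_add_distrib]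
  refine Finset.sum_le_sum fun k _ => ?_
  rw [← mul_add]
  refine mul_le_mul_of_nonneg_left ?_ (hw k)
  calc _ = |(u k - u (prev k)) - (v k - v (prev k))| := by ring_nf
    _ ≤ _ := abs_sub _ _

/-- Slow-rate oracle inequality: when the weights dominate the noise, the estimator is compared
with any centred vector at the price of four times its weighted total variation. -/
lemma slow_rate (hn : 0 < n) (hb : ∀ i j k, x i j ∈ bin D k ↔ b i j = k)
    {w : Fin p → Fin D → ℝ} (hw : ∀ j k, 0 ≤ w j k) {y : Fin n → ℝ}
    (g : (Fin p → ℝ) → ℝ)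
    (he : ∀ j, ∀ k, |tailNoise b (fun i => y i - g (x i)) j k| ≤ w j k)
    {θ : Fin p → Fin D → ℝ} (hθ : IsBinarsityEstimator x w y θ)
    {h : Fin p → Fin D → ℝ} (hh : ∀ j, BlockCentered x j (h j)) :
    empNormSq x (fun z => mFun θ z - g z) ≤
      empNormSq x (fun z => mFun h z - g z) + 4 * ∑ j, tvOn (w j) (h j) (jumpIdx D) := by
  have hc := fun j => hθ.blockCentered hw j
  have hmin := hθ h
  rw [bina_eq_coe w θ hc, bina_eq_coe w h hh, ← EReal.coe_add, ← EReal.coe_add,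
    EReal.coe_le_coe_iff] at hmin
  have hnoise := abs_noise_le hn he (u := fun j k => θ j k - h j k) fun j => by
    have h1 := (blockCentered_iff hb j _).mp (hc j)
    have h2 := (blockCentered_iff hb j _).mp (hh j)
    simp [Finset.sum_sub_distrib, h1, h2]
  have htv : ∑ j, tvOn (w j) (fun k => θ j k - h j k) (jumpIdx D) ≤
      ∑ j, tvOn (w j) (θ j) (jumpIdx D) + ∑ j, tvOn (w j) (h j) (jumpIdx D) := by
    rw [← Finset.sum_add_distrib]
    exact Finset.sum_le_sum fun j _ => tvOn_sub_le (hw j) _ _ _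
  have hid : empNormSq x (fun z => mFun θ z - g z) =
      empNormSq x (fun z => mFun h z - g z) + 2 * (leastSquares x y θ - leastSquares x y h)
        + 2 * (1 / (n : ℝ) * ∑ i, (y i - g (x i)) * ∑ j, (θ j (b i j) - h j (b i j))) := by
    unfold empNormSq leastSquares
    simp only [Finset.sum_sub_distrib, ← mFun_eq hb]
    have : ∀ a c d e f : ℝ, c = d + 2 * (e - f) + 2 * a → 1 / (n : ℝ) * c = 1 / (n : ℝ) * d +
        2 * (1 / (n : ℝ) * e - 1 / (n : ℝ) * f) + 2 * (1 / (n : ℝ) * a) := by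
      intro a c d e f h; rw [h]; ring
    apply this
    rw [← Finset.sum_sub_distrib, Finset.mul_sum, Finset.mul_sum, ← Finset.sum_add_distrib,
      ← Finset.sum_add_distrib]
    refine Finset.sum_congr rfl fun i _ => ?_
    ring
  -- Minimality contributes `2 (TV h - TV θ)` and the noise `2 (TV θ + TV h)`: the variation of `θ`
  -- cancels and `4 TV h` remains.
  have := le_abs_self (1 / (n : ℝ) * ∑ i, (y i - g (x i)) * ∑ j, (θ j (b i j) - h j (b i j)))
  linarith

end SlowRate

/-! ### Upper bounds on the restricted eigenvalue. -/

section Kappa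

variable {n p D : ℕ} {x : Fin n → Fin p → ℝ} {b : Fin n → Fin p → Fin D}

/-- The proportion of the sample in a bin. -/
noncomputable def binProp (x : Fin n → Fin p → ℝ) (j : Fin p) (k : Fin D) : ℝ := (binCount D x j k : ℝ) / n

/-- The centred indicator of one bin of one feature. -/
noncomputable def bump (x : Fin n → Fin p → ℝ) (j : Fin p) (k : Fin D) : Fin p → Fin D → ℝ :=
  fun j' l => if j' = j then (if l = k then 1 else 0) - binProp x j k else 0

lemma sum_bin_eq (hn : 0 < n) (hb : ∀ i j k, x i j ∈ bin D k ↔ b i j = k) (j : Fin p)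
    (k : Fin D) : ∑ i, (if b i j = k then (1 : ℝ) else 0) = n * binProp x j k := by
  rw [Finset.sum_boole, binProp, binCount_eq hb]
  have : (n : ℝ) ≠ 0 := by positivity
  field_simp

/-- The bump jumps up at `k`, inside `K`, and down at `k + 1` (if that bin exists). Weights decrease
along a block, so the second jump costs no more than the first. -/
lemma bump_mem_cone (hn : 0 < n) (hb : ∀ i j k, x i j ∈ bin D k ↔ b i j = k)
    {w : Fin p → Fin D → ℝ} (hw : ∀ j k, 0 ≤ w j k)
    (hanti : ∀ j, ∀ k l, k ≤ l → w j l ≤ w j k) {K : Fin p → Finset (Fin D)} {j : Fin p}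
    {k : Fin D} (hk : k ∈ K j) (hk0 : k ∈ jumpIdx D) : bump x j k ∈ cone x w K := by
  have hk0' : 0 < k.val := by simpa [jumpIdx] using hk0
  constructor
  · intro j'
    rw [blockCentered_iff hb]
    by_cases hj : j' = j
    · subst hj
      simp only [bump, if_true, Finset.sum_sub_distrib, sum_bin_eq hn hb]
      simp
    · simp [bump, hj]
  · have hz : ∀ j' ≠ j, ∀ S, tvOn (w j') (bump x j k j') S = 0 := by
      intro j' hj S
      simp [tvOn, bump, hj]
    rw [Finset.sum_eq_single j (fun j' _ hj => hz j' hj _) (by simp),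
      Finset.sum_eq_single j (fun j' _ hj => hz j' hj _) (by simp)]
    have h1 : w j k ≤ tvOn (w j) (bump x j k j) (K j) := by
      have : w j k * |bump x j k j k - bump x j k j (prev k)| = w j k := by
        have : prev k ≠ k := by
          intro h; have := congrArg Fin.val h; simp [prev] at this; omega
        simp [bump, this]
      rw [← this]
      exact Finset.single_le_sum (f := fun l => w j l * |bump x j k j l - bump x j k j (prev l)|)
        (fun l _ => mul_nonneg (hw j l) (abs_nonneg _)) hk
    have h2 : tvOn (w j) (bump x j k j) (jumpIdx D \ K j) ≤ w j k := by
      unfold tvOn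
      by_cases hs : k.val + 1 < D
      · calc _ ≤ ∑ l ∈ jumpIdx D \ K j, (if l = ⟨k.val + 1, hs⟩ then w j k else 0) := by
              refine Finset.sum_le_sum fun l hl => ?_
              rw [Finset.mem_sdiff] at hl
              have hl0 : 0 < l.val := by simpa [jumpIdx] using hl.1
              have hlk : l ≠ k := fun h => hl.2 (h ▸ hk)
              split_ifs with h
              · have : prev l = k := by subst h; simp [prev]
                have e : bump x j k j l - bump x j k j (prev l) = -1 := by
                  simp only [bump, if_true, this, hlk, if_false]
                  ring
                rw [e, abs_neg, abs_one, mul_one]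
                exact hanti j k l (by subst h; simp [Fin.le_def])
              · have : prev l ≠ k := by
                  intro h'; apply h; ext; have := congrArg Fin.val h'; simp [prev] at this ⊢; omega
                simp [bump, this, hlk]
          _ ≤ w j k := by
              rw [Finset.sum_ite_eq']
              split_ifs
              · exact le_rfl
              · exact hw j k
      · rw [Finset.sum_eq_zero]
        · exact hw j k
        · intro l hl
          rw [Finset.mem_sdiff] at hl
          have hl0 : 0 < l.val := by simpa [jumpIdx] using hl.1
          have hlk : l ≠ k := fun h => hl.2 (h ▸ hk)
          have : prev l ≠ k := by
            intro h'; have := congrArg Fin.val h'; simp [prev] at this; omega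
          simp [bump, this, hlk]
    have := hw j k
    linarith

lemma sum_mFun_bump_sq (hn : 0 < n) (hb : ∀ i j k, x i j ∈ bin D k ↔ b i j = k) (j : Fin p)
    (k : Fin D) : ∑ i, mFun (bump x j k) (x i) ^ 2 =
      n * (binProp x j k * (1 - binProp x j k)) := by
  have h1 : ∀ i, mFun (bump x j k) (x i) ^ 2 =
      (1 - 2 * binProp x j k) * (if b i j = k then (1 : ℝ) else 0) + binProp x j k ^ 2 := by
    intro i
    rw [mFun_eq hb, Finset.sum_eq_single j]
    · simp only [bump, if_true]; split_ifs <;> ring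
    · intro j' _ hj; simp [bump, hj]
    · simp
  rw [Finset.sum_congr rfl fun i _ => h1 i, Finset.sum_add_distrib, ← Finset.mul_sum,
    sum_bin_eq hn hb]
  simp
  ring

lemma binProp_nonneg (x : Fin n → Fin p → ℝ) (j : Fin p) (k : Fin D) : 0 ≤ binProp x j k := by
  unfold binProp; positivity

/-- The bump at `k` has mean square `f (1 - f)` on the sample, while its coordinate at `k` alone
already equals `1 - f`. -/
lemma kappa_le (hn : 0 < n) (hb : ∀ i j k, x i j ∈ bin D k ↔ b i j = k)
    {w : Fin p → Fin D → ℝ} (hw : ∀ j k, 0 ≤ w j k)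
    (hanti : ∀ j, ∀ k l, k ≤ l → w j l ≤ w j k) {K : Fin p → Finset (Fin D)} {j : Fin p}
    {k : Fin D} (hk : k ∈ K j) (hk0 : k ∈ jumpIdx D) (hf : binProp x j k < 1) :
    kappa x w K ≤ ENNReal.ofReal (Real.sqrt (binProp x j k / (1 - binProp x j k))) := by
  set f := binProp x j k with hfdef
  have hf0 : 0 ≤ f := binProp_nonneg x j k
  have h1f : 0 < 1 - f := by linarith
  have hnorm : 1 - f ≤ restrNorm (bump x j k) K := by
    unfold restrNorm
    apply Real.le_sqrt_of_sq_le
    calc (1 - f) ^ 2 = bump x j k j k ^ 2 := by simp [bump, hfdef]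
      _ ≤ ∑ l ∈ K j, bump x j k j l ^ 2 :=
        Finset.single_le_sum (f := fun l => bump x j k j l ^ 2) (fun l _ => sq_nonneg _) hk
      _ ≤ _ := Finset.single_le_sum (f := fun j' => ∑ l ∈ K j', bump x j k j' l ^ 2)
        (fun j' _ => Finset.sum_nonneg fun l _ => sq_nonneg _) (Finset.mem_univ j)
  have hmem : bump x j k ∈ {u | u ∈ cone x w K ∧ restrNorm u K ≠ 0} :=
    ⟨bump_mem_cone hn hb hw hanti hk hk0, by linarith⟩
  refine (iInf₂_le _ hmem).trans (ENNReal.ofReal_le_ofReal ?_)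
  have hn' : (0 : ℝ) < n := by exact_mod_cast hn
  rw [sum_mFun_bump_sq hn hb, ← hfdef, Real.sqrt_mul hn'.le]
  have hs : 0 < Real.sqrt n := Real.sqrt_pos.mpr hn'
  rw [mul_div_mul_left _ _ hs.ne']
  calc _ ≤ Real.sqrt (f * (1 - f)) / (1 - f) := by gcongr
    _ = Real.sqrt (f / (1 - f)) := by
      rw [Real.sqrt_div hf0, Real.sqrt_mul hf0, div_eq_div_iff h1f.ne' (Real.sqrt_ne_zero'.mpr h1f),
        mul_assoc, Real.mul_self_sqrt h1f.le]

lemma binProp_pos_of_kappa_pos (hn : 0 < n) (hb : ∀ i j k, x i j ∈ bin D k ↔ b i j = k)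
    {w : Fin p → Fin D → ℝ} (hw : ∀ j k, 0 ≤ w j k)
    (hanti : ∀ j, ∀ k l, k ≤ l → w j l ≤ w j k) {K : Fin p → Finset (Fin D)}
    (hκ : 0 < kappa x w K) {j : Fin p}
    {k : Fin D} (hk : k ∈ K j) (hk0 : k ∈ jumpIdx D) : 0 < binProp x j k := by
  by_contra h
  have h0 : binProp x j k = 0 := le_antisymm (not_lt.mp h) (binProp_nonneg x j k)
  have := kappa_le hn hb hw hanti hk hk0 (by rw [h0]; norm_num)
  rw [h0] at this
  simp at this
  exact hκ.ne' this

/-- The form with `t` avoids dividing by the bin proportion. Positivity of `kappa` keeps the inverse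
finite, so `toReal` loses nothing. -/
lemma le_inv_kappa_sq (hn : 0 < n) (hb : ∀ i j k, x i j ∈ bin D k ↔ b i j = k)
    {w : Fin p → Fin D → ℝ} (hw : ∀ j k, 0 ≤ w j k)
    (hanti : ∀ j, ∀ k l, k ≤ l → w j l ≤ w j k) {K : Fin p → Finset (Fin D)}
    (hκ : 0 < kappa x w K) {j : Fin p}
    {k : Fin D} (hk : k ∈ K j) (hk0 : k ∈ jumpIdx D) {t : ℝ} (ht : 0 < t)
    (hf : t * binProp x j k ≤ 1 - binProp x j k) :
    t ≤ ((kappa x w K ^ 2)⁻¹).toReal := by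
  have hf0 := binProp_pos_of_kappa_pos hn hb hw hanti hκ hk hk0
  have h1f : 0 < 1 - binProp x j k := lt_of_lt_of_le (mul_pos ht hf0) hf
  have h := kappa_le hn hb hw hanti hk hk0 (by linarith)
  have h2 : kappa x w K ^ 2 ≤ ENNReal.ofReal t⁻¹ := by
    calc _ ≤ ENNReal.ofReal (Real.sqrt (binProp x j k / (1 - binProp x j k))) ^ 2 := by gcongr
      _ = ENNReal.ofReal (binProp x j k / (1 - binProp x j k)) := by
        rw [← ENNReal.ofReal_pow (Real.sqrt_nonneg _), Real.sq_sqrt (by positivity)]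
      _ ≤ _ := by
        apply ENNReal.ofReal_le_ofReal
        rw [div_le_iff₀ h1f, inv_mul_eq_div, le_div_iff₀ ht]
        linarith
  have h3 : ENNReal.ofReal t ≤ (kappa x w K ^ 2)⁻¹ := by
    rw [ENNReal.le_inv_iff_le_inv, ← ENNReal.ofReal_inv_of_pos ht]
    exact h2
  have h4 : (kappa x w K ^ 2)⁻¹ ≠ ⊤ := by
    rw [ENNReal.inv_ne_top]; exact pow_ne_zero _ hκ.ne'
  calc t = (ENNReal.ofReal t).toReal := (ENNReal.toReal_ofReal ht.le).symm
    _ ≤ _ := ENNReal.toReal_mono h4 h3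

end Kappa

/-! ### Gaussian concentration and the union bound. -/

section Noise

variable {Ω : Type*} [MeasurableSpace Ω] {μ : Measure Ω}

lemma hasSubgaussianMGF_of_hasLaw_gaussianReal {X : Ω → ℝ} {m : ℝ} {v : ℝ≥0}
    (h : HasLaw X (gaussianReal m v) μ) : HasSubgaussianMGF (fun ω => X ω - m) v μ := by
  have h0 : HasLaw (fun ω => X ω - m) (gaussianReal 0 v) μ := by
    simpa using gaussianReal_sub_const h m
  refine (HasSubgaussianMGF.id_map_iff h0.aemeasurable).mp ?_
  rw [h0.map_eq]
  refine ⟨fun t => by simpa using integrable_exp_mul_gaussianReal t, fun t => ?_⟩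
  rw [mgf_id_gaussianReal]
  simp

/-- A weighted sum of independent centred Gaussian variables is sub-Gaussian. -/
lemma hasSubgaussianMGF_weighted_sum {n : ℕ} {Y : Fin n → Ω → ℝ} {m : Fin n → ℝ} {v : ℝ≥0}
    (hlaw : ∀ i, HasLaw (Y i) (gaussianReal (m i) v) μ) (hindep : iIndepFun Y μ)
    (c : Fin n → ℝ) {V : ℝ≥0} (hV : (∑ i, c i ^ 2) * v ≤ V) :
    HasSubgaussianMGF (fun ω => ∑ i, c i * (Y i ω - m i)) V μ := by
  have h1 : iIndepFun (fun i ω => c i * (Y i ω - m i)) μ :=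
    hindep.comp (fun i y => c i * (y - m i)) fun i => by fun_prop
  have h2 := HasSubgaussianMGF.sum_of_iIndepFun h1 (s := Finset.univ)
    fun i _ => (hasSubgaussianMGF_of_hasLaw_gaussianReal (hlaw i)).const_mul (c i)
  refine ⟨h2.integrable_exp_mul, fun t => (h2.mgf_le t).trans ?_⟩
  gcongr
  rw [← NNReal.coe_le_coe]
  refine le_trans (le_of_eq ?_) hV
  rw [NNReal.coe_sum, Finset.sum_mul]
  exact Finset.sum_congr rfl fun i _ => NNReal.coe_mul _ _

lemma measure_abs_gt_le [IsProbabilityMeasure μ] {Z : Ω → ℝ} {V : ℝ≥0}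
    (hZ : HasSubgaussianMGF Z V μ) {t : ℝ} (ht : 0 ≤ t) :
    μ {ω | t < |Z ω|} ≤ ENNReal.ofReal (2 * Real.exp (-t ^ 2 / (2 * V))) := by
  have h1 := hZ.measure_ge_le ht
  have h2 := hZ.neg.measure_ge_le ht
  have hsub : {ω | t < |Z ω|} ⊆ {ω | t ≤ Z ω} ∪ {ω | t ≤ (-Z) ω} := by
    intro ω hω
    rcases lt_abs.mp (show t < |Z ω| from hω) with h | h
    · exact Or.inl h.le
    · exact Or.inr h.le
  calc μ {ω | t < |Z ω|} ≤ μ {ω | t ≤ Z ω} + μ {ω | t ≤ (-Z) ω} :=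
        (measure_mono hsub).trans (measure_union_le _ _)
    _ = ENNReal.ofReal (μ.real {ω | t ≤ Z ω}) + ENNReal.ofReal (μ.real {ω | t ≤ (-Z) ω}) := by
        rw [ofReal_measureReal, ofReal_measureReal]
    _ ≤ ENNReal.ofReal (Real.exp (-t ^ 2 / (2 * V))) +
        ENNReal.ofReal (Real.exp (-t ^ 2 / (2 * V))) := by gcongr
    _ = _ := by
        rw [← ENNReal.ofReal_add (Real.exp_pos _).le (Real.exp_pos _).le]
        congr 1
        ring

variable {n p D : ℕ} {x : Fin n → Fin p → ℝ} {b : Fin n → Fin p → Fin D}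

/-- Centring only reduces the sum of squares, and an indicator is its own square. -/
lemma sum_centred_tail_sq_le (hn : 0 < n) (b : Fin n → Fin D) (k : Fin D) :
    ∑ i, ((if k ≤ b i then 1 else 0) - (∑ i', if k ≤ b i' then (1 : ℝ) else 0) / n) ^ 2
      ≤ ∑ i, if k ≤ b i then (1 : ℝ) else 0 := by
  have hn' : (0 : ℝ) < n := by exact_mod_cast hn
  set s := ∑ i', if k ≤ b i' then (1 : ℝ) else 0 with hs
  have h1 : ∀ i, ((if k ≤ b i then 1 else 0) - s / n) ^ 2 =
      (1 - 2 * (s / n)) * (if k ≤ b i then (1 : ℝ) else 0) + (s / n) ^ 2 := by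
    intro i; split_ifs <;> ring
  rw [Finset.sum_congr rfl fun i _ => h1 i, Finset.sum_add_distrib, ← Finset.mul_sum, ← hs]
  simp only [Finset.sum_const, Finset.card_univ, Fintype.card_fin, nsmul_eq_mul]
  have : (1 - 2 * (s / n)) * s + n * (s / n) ^ 2 = s - s ^ 2 / n := by field_simp; ring
  rw [this]
  have : 0 ≤ s ^ 2 / n := by positivity
  linarith

lemma measure_tailNoise_gt_le [IsProbabilityMeasure μ] (hn : 0 < n)
    (hb : ∀ i j k, x i j ∈ bin D k ↔ b i j = k) {Y : Fin n → Ω → ℝ} {g : (Fin p → ℝ) → ℝ}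
    {σ : ℝ≥0} (hσ : 0 < σ)
    (hlaw : ∀ i, HasLaw (Y i) (gaussianReal (g (x i)) (σ ^ 2)) μ) (hindep : iIndepFun Y μ)
    {A : ℝ} (hA : 0 < A) (j : Fin p) (k : Fin D) :
    μ {ω | weight D x σ A j k < |tailNoise b (fun i => Y i ω - g (x i)) j k|} ≤
      ENNReal.ofReal (2 * Real.exp (-A) / ((p : ℝ) * D)) := by
  have hn' : (0 : ℝ) < n := by exact_mod_cast hn
  have hσ' : (0 : ℝ) < σ := by exact_mod_cast hσ
  have hD : (1 : ℝ) ≤ D := by exact_mod_cast k.pos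
  have hp : (1 : ℝ) ≤ p := by exact_mod_cast j.pos
  have hd : 1 ≤ (p : ℝ) * D := by nlinarith
  have hB : 0 < A + Real.log ((p : ℝ) * D) := by linarith [Real.log_nonneg hd]
  set π := tailProp D x j k with hπ
  have hπ0 : 0 ≤ π := tailProp_nonneg x j k
  have hs : ∑ i, (if k ≤ b i j then (1 : ℝ) else 0) = n * π := by
    rw [hπ, tailProp_eq hb]; field_simp
  have hsq := sum_centred_tail_sq_le hn (fun i => b i j) k
  have hsq2 : ∑ i, (1 / (n : ℝ) * ((if k ≤ b i j then 1 else 0) -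
      (∑ i', if k ≤ b i' j then (1 : ℝ) else 0) / n)) ^ 2 ≤ π / n := by
    simp only [mul_pow]
    rw [← Finset.mul_sum]
    calc _ ≤ (1 / (n : ℝ)) ^ 2 * (n * π) := by rw [← hs]; gcongr
      _ = π / n := by field_simp
  have hw0 : 0 ≤ weight D x σ A j k := Real.sqrt_nonneg _
  have hZ : HasSubgaussianMGF (fun ω => tailNoise b (fun i => Y i ω - g (x i)) j k)
      ((π / n).toNNReal * σ ^ 2) μ := by
    have := hasSubgaussianMGF_weighted_sum hlaw hindep (fun i => 1 / (n : ℝ) *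
      ((if k ≤ b i j then 1 else 0) - (∑ i', if k ≤ b i' j then (1 : ℝ) else 0) / n))
      (V := (π / n).toNNReal * σ ^ 2) (by
        push_cast
        rw [Real.coe_toNNReal _ (by positivity)]
        exact mul_le_mul_of_nonneg_right hsq2 (by positivity))
    refine this.congr (Filter.Eventually.of_forall fun ω => ?_)
    simp only [tailNoise, Finset.mul_sum, mul_assoc]
  -- With an empty tail the variance proxy vanishes, and the exponential bound would divide by zero;
  -- there the noise is almost surely `0`.
  rcases hπ0.eq_or_lt with h0 | hpos
  · have hzero : ∀ᵐ ω ∂μ, ¬ (weight D x σ A j k <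
        |tailNoise b (fun i => Y i ω - g (x i)) j k|) := by
      rw [← h0, zero_div, Real.toNNReal_zero, zero_mul] at hZ
      filter_upwards [hZ.ae_eq_zero_of_hasSubgaussianMGF_zero] with ω hω
      rw [hω]
      simpa using hw0
    have : μ {ω | weight D x σ A j k < |tailNoise b (fun i => Y i ω - g (x i)) j k|} = 0 := by
      rw [ae_iff] at hzero; simpa using hzero
    rw [this]; exact zero_le
  · refine (measure_abs_gt_le hZ hw0).trans (ENNReal.ofReal_le_ofReal ?_)
    have hw2 : weight D x σ A j k ^ 2 = 2 * σ ^ 2 * (A + Real.log ((p : ℝ) * D)) / n * π :=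
      Real.sq_sqrt (by positivity)
    have : -weight D x σ A j k ^ 2 / (2 * (((π / n).toNNReal * σ ^ 2 : ℝ≥0) : ℝ)) =
        -(A + Real.log ((p : ℝ) * D)) := by
      rw [hw2]
      push_cast
      rw [Real.coe_toNNReal _ (by positivity)]
      field_simp
    rw [this, neg_add, Real.exp_add, Real.exp_neg (Real.log _), Real.exp_log (by linarith)]
    apply le_of_eq
    ring

/-- With probability at least `1 - 2 exp (-A)`, the weights dominate the noise. -/
lemma exists_noise_event [IsProbabilityMeasure μ] (hn : 0 < n)
    (hb : ∀ i j k, x i j ∈ bin D k ↔ b i j = k) {Y : Fin n → Ω → ℝ} {g : (Fin p → ℝ) → ℝ}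
    {σ : ℝ≥0} (hσ : 0 < σ)
    (hlaw : ∀ i, HasLaw (Y i) (gaussianReal (g (x i)) (σ ^ 2)) μ) (hindep : iIndepFun Y μ)
    {A : ℝ} (hA : 0 < A) :
    ∃ E : Set Ω, MeasurableSet E ∧ ENNReal.ofReal (1 - 2 * Real.exp (-A)) ≤ μ E ∧
      ∀ ω ∈ E, ∀ j, ∀ k, |tailNoise b (fun i => Y i ω - g (x i)) j k| ≤ weight D x σ A j k := by
  set bad : Set Ω := ⋃ jk : Fin p × Fin D, {ω | weight D x σ A jk.1 jk.2 <
    |tailNoise b (fun i => Y i ω - g (x i)) jk.1 jk.2|} with hbad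
  -- A measurable hull has the same measure, which avoids proving that the bad event is measurable.
  refine ⟨(toMeasurable μ bad)ᶜ, (measurableSet_toMeasurable μ bad).compl, ?_, ?_⟩
  · have h1 : μ (toMeasurable μ bad) ≤ ENNReal.ofReal (2 * Real.exp (-A)) := by
      rw [measure_toMeasurable]
      calc μ bad ≤ ∑ jk : Fin p × Fin D, μ {ω | weight D x σ A jk.1 jk.2 <
              |tailNoise b (fun i => Y i ω - g (x i)) jk.1 jk.2|} := by
            rw [hbad]; exact measure_iUnion_fintype_le μ _
        _ ≤ ∑ _jk : Fin p × Fin D, ENNReal.ofReal (2 * Real.exp (-A) / ((p : ℝ) * D)) :=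
            Finset.sum_le_sum fun jk _ =>
              measure_tailNoise_gt_le hn hb hσ hlaw hindep hA jk.1 jk.2
        _ = ENNReal.ofReal ((p * D : ℕ) * (2 * Real.exp (-A) / ((p : ℝ) * D))) := by
            rw [ENNReal.ofReal_mul (by positivity), ENNReal.ofReal_natCast]
            simp
        _ ≤ _ := by
            apply ENNReal.ofReal_le_ofReal
            push_cast
            rcases eq_or_ne ((p : ℝ) * D) 0 with h0 | h0
            · rw [h0, zero_mul]; positivity
            · rw [mul_div_cancel₀ _ h0]
    rw [measure_compl (measurableSet_toMeasurable μ bad) (measure_ne_top μ _), measure_univ,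
      ENNReal.ofReal_sub _ (by positivity), ENNReal.ofReal_one]
    gcongr
  · intro ω hω j k
    by_contra h
    exact hω (subset_toMeasurable μ bad (Set.mem_iUnion.mpr ⟨(j, k), not_le.mp h⟩))

end Noise

/-! ### Total variation of paths that may restart from zero. -/

section Path

variable {D k₀ : ℕ} {θ α : ℕ → ℝ}

lemma sum_Ioc_succ (f : ℕ → ℝ) {a b : ℕ} (h : a ≤ b) :
    ∑ l ∈ Finset.Ioc a (b + 1), f l = ∑ l ∈ Finset.Ioc a b, f l + f (b + 1) := by
  rw [← Finset.insert_Ioc_right_eq_Ioc_add_one (by omega), Finset.sum_insert (by simp), add_comm]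

/-- The term `|θ k|` is a potential. A small step costs `α` twice, once for the variation and once
for the change of potential; a restart from `0` is paid in full by the new potential. -/
lemma path_sum_le
    (h : ∀ k, k₀ < k → k < D → |θ k - θ (k - 1)| ≤ α k ∨ θ (k - 1) = 0)
    (hα : ∀ k, 0 ≤ α k) {k : ℕ} (hk : k₀ ≤ k) (hkD : k < D) :
    ∑ l ∈ Finset.Ioc k₀ k, |θ l - θ (l - 1)| ≤ 2 * ∑ l ∈ Finset.Ioc k₀ k, α l + |θ k| := by
  induction k, hk using Nat.le_induction with
  | base => simp
  | succ k hk ih =>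
    rw [sum_Ioc_succ _ hk, sum_Ioc_succ _ hk]
    have ih := ih (by omega)
    have hα' := hα (k + 1)
    rcases h (k + 1) (by omega) hkD with h1 | h1
    · rw [Nat.add_sub_cancel] at *
      have := abs_sub_abs_le_abs_sub (θ k) (θ (k + 1))
      rw [abs_sub_comm] at this
      linarith
    · rw [Nat.add_sub_cancel] at *
      rw [h1] at ih ⊢
      simp at ih ⊢
      linarith

lemma path_abs_sub_le {r k : ℕ} (h : ∀ l, r < l → l ≤ k → |θ l - θ (l - 1)| ≤ α l)
    (hk : r ≤ k) : |θ k - θ r| ≤ ∑ l ∈ Finset.Ioc r k, α l := by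
  induction k, hk using Nat.le_induction with
  | base => simp
  | succ k hk ih =>
    rw [sum_Ioc_succ _ hk]
    have ih := ih fun l hl hl' => h l hl (by omega)
    have h1 := h (k + 1) (by omega) le_rfl
    rw [Nat.add_sub_cancel] at h1
    have := abs_sub_le (θ (k + 1)) (θ k) (θ r)
    linarith

/-- Read backwards: a path must come down to `0` by small steps before it can restart, so restarts
never enlarge the bound. -/
lemma path_abs_le
    (h : ∀ k, k₀ < k → k < D → |θ k - θ (k - 1)| ≤ α k ∨ θ (k - 1) = 0)
    (hα : ∀ k, 0 ≤ α k) {k k' : ℕ} (hk0 : k₀ ≤ k) (hk : k ≤ k') (hkD : k' < D) :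
    |θ k| ≤ ∑ l ∈ Finset.Ioc k k', α l + |θ k'| := by
  induction k', hk using Nat.le_induction with
  | base => simp
  | succ k' hk ih =>
    rw [sum_Ioc_succ _ hk]
    have ih := ih (by omega)
    have hα' := hα (k' + 1)
    rcases h (k' + 1) (by omega) hkD with h1 | h1
    · rw [Nat.add_sub_cancel] at h1
      have := abs_sub_abs_le_abs_sub (θ k') (θ (k' + 1))
      rw [abs_sub_comm] at this
      linarith
    · rw [Nat.add_sub_cancel] at h1
      rw [h1] at ih
      have := abs_nonneg (θ (k' + 1))
      simp at ih
      linarith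

/-- Weighted total variation of a centred path, each step of which is either bounded by `α` or
starts from `0`: the latter steps are paid by the former, up to the last one, which is controlled
by the centring. -/
lemma path_weighted_tv_le {n : ℕ} (hn : 0 < n) (b : Fin n → ℕ) (hb0 : ∀ i, k₀ ≤ b i)
    (hbD : ∀ i, b i < D) (hcent : ∑ i, θ (b i) = 0)
    (h : ∀ k, k₀ < k → k < D → |θ k - θ (k - 1)| ≤ α k ∨ θ (k - 1) = 0)
    (hα : ∀ k, 0 ≤ α k) {V : ℝ} (hV : ∀ k, k₀ < k → k < D → θ (k - 1) = 0 → |θ k| ≤ V)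
    {a : ℝ} (ha : ∑ l ∈ Finset.Ioo k₀ D, α l ≤ a) (π : ℕ → ℝ)
    (hπ : ∀ k, π k = (∑ i, if k ≤ b i then (1 : ℝ) else 0) / n) :
    ∑ k ∈ Finset.Ioo k₀ D, √(π k) * |θ k - θ (k - 1)| ≤ 2 * a + √(a * V) := by
  have hn' : (0 : ℝ) < n := by exact_mod_cast hn
  have hπ1 : ∀ k, √(π k) ≤ 1 := by
    intro k
    rw [Real.sqrt_le_one, hπ]
    apply div_le_one_of_le₀ _ hn'.le
    calc _ ≤ ∑ i : Fin n, (1 : ℝ) := by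
          gcongr with i; split_ifs <;> norm_num
      _ = n := by simp
  have hpart : ∀ s ⊆ Finset.Ioo k₀ D, ∑ l ∈ s, α l ≤ a := fun s hs =>
    (Finset.sum_le_sum_of_subset_of_nonneg hs fun l _ _ => hα l).trans ha
  have ha0 : 0 ≤ a := by simpa using hpart ∅ (by simp)
  have hroot := Real.sqrt_nonneg (a * V)
  by_cases hbad : ∃ k, k₀ < k ∧ k < D ∧ ¬ |θ k - θ (k - 1)| ≤ α k
  swap
  · push Not at hbad
    calc _ ≤ ∑ k ∈ Finset.Ioo k₀ D, α k := by
          refine Finset.sum_le_sum fun k hk => ?_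
          rw [Finset.mem_Ioo] at hk
          calc _ ≤ 1 * α k := mul_le_mul (hπ1 k) (hbad k hk.1 hk.2) (abs_nonneg _) zero_le_one
            _ = α k := one_mul _
      _ ≤ _ := by linarith
  classical
  -- `r` is the last large step: the path vanishes just before it and makes only small steps after
  -- it.
  obtain ⟨r, ⟨hr0, hrD, hr⟩, hmax⟩ : ∃ r, (k₀ < r ∧ r < D ∧ ¬ |θ r - θ (r - 1)| ≤ α r) ∧
      ∀ k, r < k → k < D → |θ k - θ (k - 1)| ≤ α k := by
    obtain ⟨k, hk0, hkD, hk⟩ := hbad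
    refine ⟨Nat.findGreatest (fun k => k₀ < k ∧ k < D ∧ ¬ |θ k - θ (k - 1)| ≤ α k) D,
      Nat.findGreatest_spec (P := fun k => k₀ < k ∧ k < D ∧ ¬ |θ k - θ (k - 1)| ≤ α k)
        hkD.le ⟨hk0, hkD, hk⟩, fun l hl hlD => ?_⟩
    have h1 := Nat.findGreatest_spec (P := fun k => k₀ < k ∧ k < D ∧ ¬ |θ k - θ (k - 1)| ≤ α k)
        hkD.le ⟨hk0, hkD, hk⟩
    have h2 := Nat.findGreatest_is_greatest hl hlD.le
    by_contra h3
    exact h2 ⟨by omega, hlD, h3⟩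
  have hθr : θ (r - 1) = 0 := (h r hr0 hrD).resolve_left hr
  -- By centring, `π r * θ r` is an average of terms `θ r - θ (b i)` to the right of `r` and `-θ (b
  -- i)` to its left; small steps after `r` and the zero at `r - 1` bound each by `a`.
  have hmass : π r * |θ r| ≤ a := by
    have e : π r * θ r = (∑ i, if r ≤ b i then θ r - θ (b i) else - θ (b i)) / n := by
      have : ∀ i, (if r ≤ b i then θ r - θ (b i) else - θ (b i)) =
          (if r ≤ b i then (1 : ℝ) else 0) * θ r - θ (b i) := by
        intro i; split_ifs <;> ring
      rw [Finset.sum_congr rfl fun i _ => this i, Finset.sum_sub_distrib, hcent, sub_zero,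
        ← Finset.sum_mul, hπ]
      ring
    have hπ0 : 0 ≤ π r := by
      rw [hπ]; exact div_nonneg (Finset.sum_nonneg fun i _ => by split_ifs <;> norm_num) hn'.le
    rw [← abs_of_nonneg hπ0, ← abs_mul, e, abs_div, abs_of_pos hn', div_le_iff₀ hn']
    calc _ ≤ ∑ i, |if r ≤ b i then θ r - θ (b i) else - θ (b i)| :=
          Finset.abs_sum_le_sum_abs _ _
      _ ≤ ∑ i : Fin n, a := by
          refine Finset.sum_le_sum fun i _ => ?_
          split_ifs with hi
          · rw [abs_sub_comm]
            refine (path_abs_sub_le (α := α) (fun l hl hl' => hmax l hl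
              (lt_of_le_of_lt hl' (hbD i))) hi).trans (hpart _ fun l hl => ?_)
            have := hbD i
            simp only [Finset.mem_Ioc, Finset.mem_Ioo] at hl ⊢
            omega
          · rw [abs_neg]
            have h1 := path_abs_le h hα (hb0 i) (show b i ≤ r - 1 by omega) (by omega)
            rw [hθr, abs_zero, add_zero] at h1
            refine h1.trans (hpart _ fun l hl => ?_)
            have := hb0 i
            simp only [Finset.mem_Ioc, Finset.mem_Ioo] at hl ⊢
            omega
      _ = a * n := by simp [mul_comm]
  -- The square factors as `(π r * |θ r|) * |θ r|`.
  have hlast : √(π r) * |θ r| ≤ √(a * V) := by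
    apply Real.le_sqrt_of_sq_le
    have hπ0 : 0 ≤ π r := by
      rw [hπ]; exact div_nonneg (Finset.sum_nonneg fun i _ => by split_ifs <;> norm_num) hn'.le
    rw [mul_pow, Real.sq_sqrt hπ0, sq, ← mul_assoc]
    exact mul_le_mul hmass (hV r hr0 hrD hθr) (abs_nonneg _) ha0
  have hsplit : Finset.Ioo k₀ D = (Finset.Ioc k₀ (r - 1) ∪ Finset.Ioo r D) ∪ {r} := by
    ext l; simp only [Finset.mem_union, Finset.mem_Ioo, Finset.mem_Ioc, Finset.mem_singleton]
    omega
  have hd1 : Disjoint (Finset.Ioc k₀ (r - 1)) (Finset.Ioo r D) := by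
    rw [Finset.disjoint_left]; intro l; simp only [Finset.mem_Ioo, Finset.mem_Ioc]; omega
  have hd2 : Disjoint (Finset.Ioc k₀ (r - 1) ∪ Finset.Ioo r D) {r} := by
    rw [Finset.disjoint_left]; intro l
    simp only [Finset.mem_union, Finset.mem_Ioo, Finset.mem_Ioc, Finset.mem_singleton]; omega
  have hleft : ∑ k ∈ Finset.Ioc k₀ (r - 1), √(π k) * |θ k - θ (k - 1)| ≤
      2 * ∑ k ∈ Finset.Ioc k₀ (r - 1), α k := by
    have h1 := path_sum_le h hα (show k₀ ≤ r - 1 by omega) (by omega)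
    rw [hθr, abs_zero, add_zero] at h1
    refine le_trans (Finset.sum_le_sum fun k _ => ?_) h1
    exact mul_le_of_le_one_left (abs_nonneg _) (hπ1 k)
  have hright : ∑ k ∈ Finset.Ioo r D, √(π k) * |θ k - θ (k - 1)| ≤
      ∑ k ∈ Finset.Ioo r D, α k := by
    refine Finset.sum_le_sum fun k hk => ?_
    rw [Finset.mem_Ioo] at hk
    calc _ ≤ 1 * α k := mul_le_mul (hπ1 k) (hmax k hk.1 hk.2) (abs_nonneg _) zero_le_one
      _ = α k := one_mul _
  have hsum : ∑ k ∈ Finset.Ioc k₀ (r - 1), α k + ∑ k ∈ Finset.Ioo r D, α k ≤ a := by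
    rw [← Finset.sum_union hd1]
    exact hpart _ (by rw [hsplit]; exact Finset.subset_union_left)
  have hr_nonneg : 0 ≤ ∑ k ∈ Finset.Ioo r D, α k := Finset.sum_nonneg fun k _ => hα k
  rw [hsplit, Finset.sum_union hd2, Finset.sum_union hd1, Finset.sum_singleton, hθr, sub_zero]
  linarith

end Path

/-! ### Bin averages of a Lipschitz function. -/

section Block

variable {n D : ℕ} {c : Fin n → Fin D} {t : Fin n → ℝ} {f : ℝ → ℝ} {L : ℝ≥0}

/-- The average of `f` over the sample points in each bin (`0` on a bin without samples). -/
noncomputable def binAvg (c : Fin n → Fin D) (t : Fin n → ℝ) (f : ℝ → ℝ) (k : Fin D) : ℝ :=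
  (∑ i, f (t i) * if c i = k then 1 else 0) / ∑ i, if c i = k then (1 : ℝ) else 0

lemma sum_ite_nonneg (c : Fin n → Fin D) (k : Fin D) :
    0 ≤ ∑ i, if c i = k then (1 : ℝ) else 0 :=
  Finset.sum_nonneg fun i _ => by split_ifs <;> norm_num

lemma sum_ite_pos {k : Fin D} (hk : ∃ i, c i = k) : 0 < ∑ i, if c i = k then (1 : ℝ) else 0 := by
  obtain ⟨i, hi⟩ := hk
  refine Finset.sum_pos' (fun i _ => by split_ifs <;> norm_num) ⟨i, Finset.mem_univ i, ?_⟩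
  simp [hi]

lemma binAvg_of_empty {k : Fin D} (hk : ¬ ∃ i, c i = k) : binAvg c t f k = 0 := by
  push Not at hk
  simp [binAvg, hk]

/-- Bin averaging is the orthogonal projection onto functions constant on bins. The convention on
empty bins is harmless, since no sample sees them. -/
lemma sum_mul_sub_binAvg (v : Fin D → ℝ) :
    ∑ i, v (c i) * (f (t i) - binAvg c t f (c i)) = 0 := by
  have h : ∀ i, v (c i) * (f (t i) - binAvg c t f (c i)) =
      ∑ k, v k * (f (t i) * (if c i = k then 1 else 0) -
        binAvg c t f k * (if c i = k then 1 else 0)) := by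
    intro i
    rw [Finset.sum_eq_single (c i)]
    · simp
    · intro k _ hk; simp [hk.symm]
    · simp
  rw [Finset.sum_congr rfl fun i _ => h i, Finset.sum_comm]
  refine Finset.sum_eq_zero fun k _ => ?_
  rw [← Finset.mul_sum, Finset.sum_sub_distrib, ← Finset.mul_sum]
  by_cases hk : ∃ i, c i = k
  · rw [binAvg, div_mul_cancel₀ _ (sum_ite_pos hk).ne', sub_self, mul_zero]
  · push Not at hk
    simp [hk]

lemma sum_binAvg : ∑ i, binAvg c t f (c i) = ∑ i, f (t i) := by
  have := sum_mul_sub_binAvg (c := c) (t := t) (f := f) fun _ => 1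
  simp only [one_mul, Finset.sum_sub_distrib] at this
  linarith

lemma sum_sq_sub_eq (h : Fin D → ℝ) :
    ∑ i, (f (t i) - h (c i)) ^ 2 = ∑ i, (f (t i) - binAvg c t f (c i)) ^ 2 +
      ∑ i, (binAvg c t f (c i) - h (c i)) ^ 2 := by
  have := sum_mul_sub_binAvg (c := c) (t := t) (f := f) fun k => 2 * (binAvg c t f k - h k)
  rw [← Finset.sum_add_distrib, ← sub_eq_zero, ← Finset.sum_sub_distrib, ← this]
  refine Finset.sum_congr rfl fun i _ => ?_
  ring

variable (hf : LipschitzWith L f) (hc : ∀ i, t i ∈ bin D (c i))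
include hf hc

lemma abs_sub_mid_le (i : Fin n) : |f (t i) - f (binMid D (c i))| ≤ L / (2 * D) := by
  have h := hf.dist_le_mul (t i) (binMid D (c i))
  rw [Real.dist_eq, Real.dist_eq] at h
  calc _ ≤ _ := h
    _ ≤ L * (1 / (2 * D)) := by gcongr; exact abs_sub_binMid_le (hc i)
    _ = _ := by ring

lemma sum_sq_sub_binAvg_le :
    ∑ i, (f (t i) - binAvg c t f (c i)) ^ 2 ≤ n * ((L : ℝ) ^ 2 / (4 * D ^ 2)) := by
  have h := sum_sq_sub_eq (c := c) (t := t) (f := f) fun k => f (binMid D k)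
  have h0 : 0 ≤ ∑ i, (binAvg c t f (c i) - f (binMid D (c i))) ^ 2 :=
    Finset.sum_nonneg fun i _ => sq_nonneg _
  have h1 : ∑ i, (f (t i) - f (binMid D (c i))) ^ 2 ≤ ∑ i : Fin n, (L : ℝ) ^ 2 / (4 * D ^ 2) := by
    refine Finset.sum_le_sum fun i _ => ?_
    calc _ = |f (t i) - f (binMid D (c i))| ^ 2 := (sq_abs _).symm
      _ ≤ (L / (2 * D)) ^ 2 := by gcongr; exact abs_sub_mid_le hf hc i
      _ = _ := by rw [div_pow]; ring
  simp only [Finset.sum_const, Finset.card_univ, Fintype.card_fin, nsmul_eq_mul] at h1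
  linarith

lemma abs_binAvg_sub_mid_le {k : Fin D} (hk : ∃ i, c i = k) :
    |binAvg c t f k - f (binMid D k)| ≤ L / (2 * D) := by
  have hN := sum_ite_pos hk
  have e : binAvg c t f k - f (binMid D k) =
      (∑ i, (f (t i) - f (binMid D k)) * if c i = k then 1 else 0) /
        ∑ i, if c i = k then (1 : ℝ) else 0 := by
    simp only [sub_mul, Finset.sum_sub_distrib]
    rw [← Finset.mul_sum, sub_div, mul_div_cancel_right₀ _ hN.ne', binAvg]
  rw [e, abs_div, abs_of_pos hN, div_le_iff₀ hN, Finset.mul_sum]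
  refine (Finset.abs_sum_le_sum_abs _ _).trans (Finset.sum_le_sum fun i _ => ?_)
  split_ifs with h
  · rw [mul_one, mul_one, ← h]; exact abs_sub_mid_le hf hc i
  · simp

lemma abs_binAvg_sub_le {k l : Fin D} (hk : ∃ i, c i = k) (hl : ∃ i, c i = l) {d : ℕ}
    (h1 : (k : ℕ) ≤ l + d) (h2 : (l : ℕ) ≤ k + d) :
    |binAvg c t f k - binAvg c t f l| ≤ L * (d + 1) / D := by
  have hD : (0 : ℝ) < D := by exact_mod_cast k.pos
  have a1 := abs_binAvg_sub_mid_le hf hc hk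
  have a2 := abs_binAvg_sub_mid_le hf hc hl
  have a3 : |f (binMid D k) - f (binMid D l)| ≤ L * (d / D) := by
    have h := hf.dist_le_mul (binMid D k) (binMid D l)
    rw [Real.dist_eq, Real.dist_eq] at h
    refine h.trans ?_
    gcongr
    have : binMid D k - binMid D l = ((k : ℝ) - l) / D := by unfold binMid; ring
    rw [this, abs_div, abs_of_pos hD]
    gcongr
    have g1 : (k : ℝ) ≤ l + d := by exact_mod_cast h1
    have g2 : (l : ℝ) ≤ k + d := by exact_mod_cast h2
    rw [abs_le]; constructor <;> linarith
  have e : (L : ℝ) * (d + 1) / D = L / (2 * D) + L / (2 * D) + L * (d / D) := by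
    field_simp; ring
  rw [e]
  rw [abs_le] at *
  constructor <;> linarith

lemma abs_binAvg_le (hn : 0 < n) (h0 : ∑ i, f (t i) = 0) {k : Fin D} (hk : ∃ i, c i = k) :
    |binAvg c t f k| ≤ L := by
  have hn' : (0 : ℝ) < n := by exact_mod_cast hn
  have hD : (0 : ℝ) < D := by exact_mod_cast k.pos
  have e : n * binAvg c t f k = ∑ i, (binAvg c t f k - binAvg c t f (c i)) := by
    rw [Finset.sum_sub_distrib, sum_binAvg, h0]; simp
  have h1 : |n * binAvg c t f k| ≤ ∑ i : Fin n, (L : ℝ) := by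
    rw [e]
    refine (Finset.abs_sum_le_sum_abs _ _).trans (Finset.sum_le_sum fun i _ => ?_)
    -- Any two bins are at most `D - 1` apart, so two occupied averages differ by at most `L`; a
    -- centred family with this oscillation is bounded by `L`.
    refine (abs_binAvg_sub_le hf hc hk ⟨i, rfl⟩ (d := D - 1) (by omega) (by omega)).trans ?_
    have : ((D - 1 : ℕ) : ℝ) + 1 = D := by exact_mod_cast Nat.sub_add_cancel k.pos
    rw [this, mul_div_cancel_right₀ _ hD.ne']
  rw [abs_mul, abs_of_pos hn'] at h1
  simp at h1
  exact le_of_mul_le_mul_left h1 hn'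

end Block

lemma sum_Ioo_eq {D : ℕ} (k₀ : Fin D) (F : ℕ → ℝ) :
    ∑ l ∈ Finset.Ioo k₀.val D, F l = ∑ k ∈ (jumpIdx D).filter (k₀ < ·), F k.val := by
  symm
  refine Finset.sum_nbij (fun k => k.val) ?_ ?_ ?_ ?_
  · intro k hk
    have h : k₀ < k := (Finset.mem_filter.mp hk).2
    exact Finset.mem_Ioo.mpr ⟨h, k.isLt⟩
  · intro a _ b _ h; exact Fin.ext h
  · intro l hl
    have h := Finset.mem_Ioo.mp (Finset.mem_coe.mp hl)
    refine ⟨⟨l, h.2⟩, ?_, rfl⟩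
    simp only [jumpIdx, Finset.coe_filter, Finset.mem_filter, Finset.mem_univ, true_and,
      Set.mem_ofPred_eq]
    exact ⟨by omega, h.1⟩
  · intro _ _; rfl

/-- Extension by zero of a block to all the natural indices. -/
noncomputable def extend {D : ℕ} (θ : Fin D → ℝ) (k : ℕ) : ℝ := if h : k < D then θ ⟨k, h⟩ else 0

lemma extend_val {D : ℕ} (θ : Fin D → ℝ) (k : Fin D) : extend θ k.val = θ k := by
  simp [extend]

lemma extend_val_sub_one {D : ℕ} (θ : Fin D → ℝ) (k : Fin D) :
    extend θ (k.val - 1) = θ (prev k) := extend_val θ (prev k)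

/-! ### Comparators on one active block. -/

section Comparator

variable {n D : ℕ} {c : Fin n → Fin D} {t : Fin n → ℝ} {f : ℝ → ℝ} {L : ℝ≥0}

open Classical in
/-- The jumps of a block to the right of an index. -/
noncomputable def jumpsAfter {D : ℕ} (k₀ : Fin D) (θ : Fin D → ℝ) : Finset (Fin D) :=
  ((jumpIdx D).filter (k₀ < ·)).filter fun k => θ k ≠ θ (prev k)

lemma abs_jump_le (hf : LipschitzWith L f) (hc : ∀ i, t i ∈ bin D (c i)) {k : Fin D}
    (hk : ∃ i, c i = k) (hk' : ∃ i, c i = prev k) :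
    |binAvg c t f k - binAvg c t f (prev k)| ≤ 2 * L / D := by
  refine (abs_binAvg_sub_le hf hc hk hk' (d := 1) ?_ ?_).trans (le_of_eq ?_)
  · simp [prev]; omega
  · simp [prev]; omega
  · push_cast; ring

/-- Taking `max k k₀` removes the jump into the first occupied bin without changing any fitted
value. Beyond `k₀`, a jump bin is occupied by `hJ`: either its predecessor is occupied too and the
step is small, or the predecessor's average is `0`. -/
lemma tv_comparator_le (hn : 0 < n) (hf : LipschitzWith L f) (hc : ∀ i, t i ∈ bin D (c i))
    (h0 : ∑ i, f (t i) = 0) {k₀ : Fin D} (hk₀ : ∀ i, k₀ ≤ c i)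
    (hJ : ∀ k, k₀ < k → binAvg c t f k ≠ binAvg c t f (prev k) → ∃ i, c i = k)
    {w : Fin D → ℝ} {lam : ℝ} (hlam : 0 ≤ lam)
    (hw : ∀ k, w k = lam * √((∑ i, if k ≤ c i then (1 : ℝ) else 0) / n)) {a : ℝ}
    (ha : 2 * L / D * ((jumpsAfter k₀ (binAvg c t f)).card : ℝ) ≤ a) :
    tvOn w (fun k => binAvg c t f (max k k₀)) (jumpIdx D) ≤ lam * (2 * a + √(a * L)) := by
  classical
  set θ := binAvg c t f with hθ
  set π : ℕ → ℝ := fun k => (∑ i, if k ≤ (c i).val then (1 : ℝ) else 0) / n with hπ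
  have hfin : ∀ k, k₀.val < k → k < D → ∃ k' : Fin D, k' ∈ (jumpIdx D).filter (k₀ < ·) ∧
      k'.val = k := fun k h1 h2 =>
    ⟨⟨k, h2⟩, Finset.mem_filter.mpr ⟨Finset.mem_filter.mpr ⟨Finset.mem_univ _, by
      change 0 < k; omega⟩, h1⟩, rfl⟩
  have hpath := path_weighted_tv_le (k₀ := k₀.val) (D := D) (θ := extend θ)
    (α := fun k => if extend θ k ≠ extend θ (k - 1) then 2 * L / D else 0) hn
    (fun i => (c i).val) (fun i => hk₀ i) (fun i => (c i).isLt)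
    (by simp only [extend_val]; rw [hθ, sum_binAvg, h0])
    (by
      intro k h1 h2
      obtain ⟨k, hk, rfl⟩ := hfin k h1 h2
      rw [extend_val, extend_val_sub_one]
      by_cases hne : θ k = θ (prev k)
      · left; simp [hne]
      · by_cases hp : ∃ i, c i = prev k
        · left
          rw [if_pos hne]
          exact abs_jump_le hf hc (hJ k (Finset.mem_filter.mp hk).2 hne) hp
        · right; exact binAvg_of_empty hp)
    (fun k => by positivity)
    (V := L)
    (by
      intro k h1 h2 _
      obtain ⟨k, hk, rfl⟩ := hfin k h1 h2
      rw [extend_val]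
      by_cases hp : ∃ i, c i = k
      · exact abs_binAvg_le hf hc hn h0 hp
      · rw [hθ, binAvg_of_empty hp]; simp)
    (a := a)
    (by
      refine le_trans (le_of_eq ?_) ha
      rw [sum_Ioo_eq]
      simp only [extend_val, extend_val_sub_one]
      rw [← Finset.sum_filter, Finset.sum_const, nsmul_eq_mul, mul_comm]
      rfl)
    π (fun k => rfl)
  refine le_trans (le_of_eq ?_) (mul_le_mul_of_nonneg_left hpath hlam)
  rw [sum_Ioo_eq, Finset.mul_sum, tvOn, ← Finset.sum_filter_add_sum_filter_not _ (k₀ < ·)]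
  have hz : ∑ k ∈ (jumpIdx D).filter (fun k => ¬ k₀ < k),
      w k * |θ (max k k₀) - θ (max (prev k) k₀)| = 0 := by
    refine Finset.sum_eq_zero fun k hk => ?_
    have h1 : k ≤ k₀ := not_lt.mp (Finset.mem_filter.mp hk).2
    have h2 : prev k ≤ k₀ := le_trans (by simp [prev, Fin.le_def]) h1
    rw [max_eq_right h1, max_eq_right h2]; simp
  rw [hz, add_zero]
  refine Finset.sum_congr rfl fun k hk => ?_
  have h1 : k₀ < k := (Finset.mem_filter.mp hk).2
  have h2 : k₀ ≤ prev k := by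
    rw [Fin.lt_def] at h1; simp [prev, Fin.le_def]; omega
  rw [max_eq_left h1.le, max_eq_left h2, extend_val, extend_val_sub_one, hw, mul_assoc]
  rfl

/-- If the bin averages have a single jump, located at a bin that contains most of the sample,
their mean square is negligible. -/
lemma sum_sq_binAvg_le (hn : 0 < n) (hf : LipschitzWith L f) (hc : ∀ i, t i ∈ bin D (c i))
    (h0 : ∑ i, f (t i) = 0) {k₀ : Fin D} (hk₀ : ∀ i, k₀ ≤ c i)
    {k : Fin D} (hs : jumpsAfter k₀ (binAvg c t f) = {k}) (hk : ∃ i, c i = k) :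
    ∑ i, binAvg c t f (c i) ^ 2 ≤
      (n - ∑ i, if c i = k then (1 : ℝ) else 0) * (2 * L / D) ^ 2 := by
  classical
  set θ := binAvg c t f with hθ
  have hkm : k ∈ jumpsAfter k₀ θ := by rw [hs]; simp
  have hkk : k₀ < k ∧ θ k ≠ θ (prev k) := by
    simp only [jumpsAfter, Finset.mem_filter] at hkm; exact ⟨hkm.1.2, hkm.2⟩
  obtain ⟨hlt, hne⟩ := hkk
  have hlt' : k₀.val < k.val := hlt
  have hno : ∀ l : ℕ, k₀.val < l → l < D → l ≠ k.val → |extend θ l - extend θ (l - 1)| ≤ 0 := by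
    intro l h1 h2 h3
    obtain ⟨l, rfl⟩ : ∃ l' : Fin D, l'.val = l := ⟨⟨l, h2⟩, rfl⟩
    rw [extend_val, extend_val_sub_one]
    by_contra hcon
    have : l ∈ jumpsAfter k₀ θ := by
      simp only [jumpsAfter, Finset.mem_filter, jumpIdx, Finset.mem_univ, true_and]
      refine ⟨⟨by omega, h1⟩, fun h => hcon (by simp [h])⟩
    rw [hs, Finset.mem_singleton] at this
    exact h3 (congrArg Fin.val this)
  have hval : ∀ i, θ (c i) = θ (prev k) + (if k ≤ c i then 1 else 0) * (θ k - θ (prev k)) := by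
    intro i
    have hi : k₀.val ≤ (c i).val := hk₀ i
    have hiD := (c i).isLt
    split_ifs with h
    · have h1 := path_abs_sub_le (θ := extend θ) (α := fun _ => 0) (r := k.val) (k := (c i).val)
        (fun l hl hl' => hno l (by omega) (by omega) (by omega)) h
      rw [extend_val, extend_val] at h1
      simp at h1
      linarith
    · rw [Fin.le_def] at h
      have h1 := path_abs_sub_le (θ := extend θ) (α := fun _ => 0) (r := (c i).val) (k := k.val - 1)
        (fun l hl hl' => hno l (by omega) (by omega) (by omega)) (by omega)
      rw [extend_val, extend_val_sub_one] at h1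
      simp at h1
      linarith
  set s := ∑ i, if k ≤ c i then (1 : ℝ) else 0 with hsdef
  have hsum : n * θ (prev k) + s * (θ k - θ (prev k)) = 0 := by
    have : ∑ i, θ (c i) = 0 := by rw [hθ, sum_binAvg, h0]
    rw [Finset.sum_congr rfl fun i _ => hval i, Finset.sum_add_distrib, ← Finset.sum_mul,
      ← hsdef] at this
    simpa only [Finset.sum_const, Finset.card_univ, Fintype.card_fin, nsmul_eq_mul] using this
  have hle : (∑ i, if c i = k then (1 : ℝ) else 0) ≤ s := by
    refine Finset.sum_le_sum fun i _ => ?_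
    split_ifs with h1 h2
    · rfl
    · exact absurd h1.ge h2
    · norm_num
    · rfl
  have hspos : 0 < s := lt_of_lt_of_le (sum_ite_pos hk) hle
  have hsn : s ≤ n := by
    calc s ≤ ∑ i : Fin n, (1 : ℝ) := Finset.sum_le_sum fun i _ => by split_ifs <;> norm_num
      _ = n := by simp
  have hstep : |θ k - θ (prev k)| ≤ 2 * L / D := by
    by_cases hp : ∃ i, c i = prev k
    · exact abs_jump_le hf hc hk hp
    -- An empty predecessor has average `0`; with a single jump, centring would then force `θ k = 0`
    -- as well.
    · exfalso
      have hz : θ (prev k) = 0 := binAvg_of_empty hp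
      rw [hz] at hsum hne
      simp at hsum
      exact hne (hsum.resolve_left hspos.ne')
  have hsq : ∑ i, θ (c i) ^ 2 = (s - s ^ 2 / n) * (θ k - θ (prev k)) ^ 2 := by
    have hn' : (n : ℝ) ≠ 0 := by positivity
    have h1 : ∀ i, θ (c i) ^ 2 = θ (prev k) ^ 2 + (if k ≤ c i then (1 : ℝ) else 0) *
        (2 * θ (prev k) * (θ k - θ (prev k)) + (θ k - θ (prev k)) ^ 2) := by
      intro i; rw [hval]; split_ifs <;> ring
    rw [Finset.sum_congr rfl fun i _ => h1 i, Finset.sum_add_distrib, ← Finset.sum_mul]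
    simp only [Finset.sum_const, Finset.card_univ, Fintype.card_fin, nsmul_eq_mul]
    rw [← hsdef]
    have h2 : θ (prev k) = -(s * (θ k - θ (prev k))) / n := by
      field_simp; linarith
    generalize θ k - θ (prev k) = d at *
    rw [h2]; field_simp; ring
  rw [hsq]
  have hn' : (0 : ℝ) < n := by exact_mod_cast hn
  have h3 : s - s ^ 2 / n ≤ n - s := by
    have : n - s - (s - s ^ 2 / n) = (n - s) ^ 2 / n := by field_simp
    have : 0 ≤ (n - s) ^ 2 / n := by positivity
    linarith
  calc _ ≤ (n - s) * (θ k - θ (prev k)) ^ 2 := mul_le_mul_of_nonneg_right h3 (sq_nonneg _)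
    _ ≤ (n - s) * (2 * L / D) ^ 2 := by
      refine mul_le_mul_of_nonneg_left ?_ (by linarith)
      rw [← sq_abs]
      gcongr
    _ ≤ _ := by gcongr

end Comparator

/-- Balance between the slow rate and the sparse rate. -/
lemma slow_rate_balance {r D s L V lam a : ℝ} (hD : 0 < D) (hDr : D ≤ r) (hrD : r ≤ 2 * D)
    (hs0 : 0 ≤ s) (hsD : s ≤ D) (hL : 0 ≤ L) (hV : 0 ≤ V) (hlam : 0 ≤ lam)
    (hlam2 : lam ^ 2 = 2 * V / r ^ 3) (ha : a = 2 * L / D * s) :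
    4 * (lam * (2 * a + √(a * L))) ≤ (2 * L ^ 2 + 288 * V * s) / r ^ 2 := by
  have hr : 0 < r := hD.trans_le hDr
  set T := √(s / D) with hT
  have hT0 : 0 ≤ T := Real.sqrt_nonneg _
  have hT2 : T ^ 2 = s / D := Real.sq_sqrt (by positivity)
  have hT1 : T ≤ 1 := by
    rw [hT, Real.sqrt_le_one]; exact div_le_one_of_le₀ hsD hD.le
  have ha' : a = 2 * L * T ^ 2 := by rw [ha, hT2]; ring
  have hroot : √(a * L) ≤ 2 * L * T := by
    apply Real.sqrt_le_iff.mpr ⟨by positivity, ?_⟩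
    rw [ha']
    nlinarith [mul_nonneg (sq_nonneg L) (sq_nonneg T)]
  have h1 : 2 * a + √(a * L) ≤ 6 * L * T := by
    have : L * T ^ 2 ≤ L * T := by
      apply mul_le_mul_of_nonneg_left _ hL; nlinarith
    rw [ha'] at hroot ⊢; linarith
  have h2 : 4 * (lam * (2 * a + √(a * L))) ≤ 24 * L * (lam * T) := by
    have := mul_le_mul_of_nonneg_left h1 hlam
    linarith
  -- This is `2 (L - 6 λ T r²)² ≥ 0`; with the factor `4` of `h4` it yields `288 = 72 · 4`.
  have h3 : 24 * L * (lam * T) * r ^ 2 ≤ 2 * L ^ 2 + 72 * (lam * T * r ^ 2) ^ 2 := by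
    nlinarith [sq_nonneg (L - 6 * (lam * T * r ^ 2))]
  have h4 : (lam * T * r ^ 2) ^ 2 ≤ 4 * V * s := by
    have : (lam * T * r ^ 2) ^ 2 = 2 * V * s * (r / D) := by
      rw [mul_pow, mul_pow, hlam2, hT2]; field_simp
    rw [this]
    have : r / D ≤ 2 := by rw [div_le_iff₀ hD]; exact hrD
    have h5 : 0 ≤ V * s := mul_nonneg hV hs0
    nlinarith
  rw [le_div_iff₀ (by positivity)]
  have := mul_le_mul_of_nonneg_right h2 (sq_nonneg r)
  linarith

/-- On an active block, there is a centred comparator whose approximation error and total variation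
are controlled, where `κi` bounds from above the odds against each bin carrying a jump. -/
lemma exists_comparator {n D : ℕ} {c : Fin n → Fin D} {t : Fin n → ℝ} {f : ℝ → ℝ} {L : ℝ≥0}
    (hn : 0 < n) (hf : LipschitzWith L f) (hc : ∀ i, t i ∈ bin D (c i))
    (h0 : ∑ i, f (t i) = 0) {r : ℝ} (hDr : (D : ℝ) ≤ r) (hrD : r ≤ 2 * D) (hrn : r ^ 3 = n)
    {V κi N : ℝ} (hV : 0 ≤ V) (hκi : 0 ≤ κi) (hN : 1 ≤ N) {w : Fin D → ℝ}
    (hw : ∀ k, w k = √(2 * V / n) * √((∑ i, if k ≤ c i then (1 : ℝ) else 0) / n))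
    (hjump : ∀ k ∈ jumpIdx D, binAvg c t f k ≠ binAvg c t f (prev k) →
      (∃ i, c i = k) ∧ ∀ s : ℝ, 0 < s → s * ((∑ i, if c i = k then (1 : ℝ) else 0) / n) ≤
        1 - (∑ i, if c i = k then (1 : ℝ) else 0) / n → s ≤ κi) :
    ∃ h : Fin D → ℝ, ∑ i, h (c i) = 0 ∧
      N * ((∑ i, (f (t i) - h (c i)) ^ 2) / n) + 4 * tvOn w h (jumpIdx D) ≤
        (3 * (L : ℝ) ^ 2 * N + 5120 * V * κi) / r ^ 2 := by
  classical
  have hn' : (0 : ℝ) < n := by exact_mod_cast hn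
  have hDpos : 0 < D := (c ⟨0, hn⟩).pos
  have hD : (0 : ℝ) < D := by exact_mod_cast hDpos
  have hr : 0 < r := hD.trans_le hDr
  have hwithin := sum_sq_sub_binAvg_le hf hc
  have hD2 : 1 / (D : ℝ) ^ 2 ≤ 4 / r ^ 2 := by
    rw [div_le_div_iff₀ (by positivity) (by positivity)]; nlinarith
  obtain ⟨i₀, -, hi₀⟩ := Finset.exists_min_image Finset.univ c ⟨⟨0, hn⟩, Finset.mem_univ _⟩
  set k₀ := c i₀ with hk₀def
  have hk₀ : ∀ i, k₀ ≤ c i := fun i => hi₀ i (Finset.mem_univ i)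
  set J := jumpsAfter k₀ (binAvg c t f) with hJdef
  have hJmem : ∀ k, k ∈ J ↔ k ∈ jumpIdx D ∧ k₀ < k ∧ binAvg c t f k ≠ binAvg c t f (prev k) := by
    intro k; simp only [hJdef, jumpsAfter, Finset.mem_filter, and_assoc]
  have hidx : ∀ k, k₀ < k → k ∈ jumpIdx D := by
    intro k hk; simp [jumpIdx]; rw [Fin.lt_def] at hk; omega
  -- The threshold `7` serves both cases: here `288 · 7 = 2016 ≤ 5120`, and in the other the sole
  -- jump bin misses at most `1/8` of the sample.
  by_cases hcase : (J.card : ℝ) ≤ 7 * κi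
  · refine ⟨fun k => binAvg c t f (max k k₀), ?_, ?_⟩
    · simp only [max_eq_left (hk₀ _)]
      rw [sum_binAvg, h0]
    · have htv := tv_comparator_le hn hf hc h0 hk₀
        (fun k hk hne => (hjump k (hidx k hk) hne).1) (Real.sqrt_nonneg _) hw le_rfl
      rw [← hJdef] at htv
      have hsD : (J.card : ℝ) ≤ D := by
        exact_mod_cast (Finset.card_le_univ J).trans (by simp)
      have hbal := slow_rate_balance (V := V) (lam := √(2 * V / n)) hD hDr hrD
        (Nat.cast_nonneg J.card) hsD L.coe_nonneg hV (Real.sqrt_nonneg _)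
        (by rw [Real.sq_sqrt (by positivity), hrn]) rfl
      simp only [max_eq_left (hk₀ _)]
      have h1 : (∑ i, (f (t i) - binAvg c t f (c i)) ^ 2) / n ≤ (L : ℝ) ^ 2 / r ^ 2 := by
        rw [div_le_iff₀ hn']
        refine hwithin.trans ?_
        have := mul_le_mul_of_nonneg_left hD2 (show 0 ≤ (L : ℝ) ^ 2 / 4 by positivity)
        calc _ = (L : ℝ) ^ 2 / 4 * (1 / (D : ℝ) ^ 2) * n := by field_simp
          _ ≤ (L : ℝ) ^ 2 / 4 * (4 / r ^ 2) * n := by gcongr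
          _ = _ := by ring
      have h2 : N * ((∑ i, (f (t i) - binAvg c t f (c i)) ^ 2) / n) ≤
          N * ((L : ℝ) ^ 2 / r ^ 2) := by gcongr
      have h3 : (2 * (L : ℝ) ^ 2 + 288 * V * J.card) / r ^ 2 + N * ((L : ℝ) ^ 2 / r ^ 2) ≤
          (3 * (L : ℝ) ^ 2 * N + 5120 * V * κi) / r ^ 2 := by
        rw [← mul_div_assoc, ← add_div]
        refine div_le_div_of_nonneg_right ?_ (sq_nonneg r)
        nlinarith [mul_le_mul_of_nonneg_left hcase hV, mul_nonneg hV hκi,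
          mul_le_mul_of_nonneg_left hN (sq_nonneg (L : ℝ))]
      linarith
  · push Not at hcase
    set F : Fin D → ℝ := fun k => (∑ i, if c i = k then (1 : ℝ) else 0) / n with hF
    have hF0 : ∀ k, 0 ≤ F k := fun k => div_nonneg (sum_ite_nonneg c k) hn'.le
    have hFsum : ∑ k ∈ J, F k ≤ 1 := by
      calc _ ≤ ∑ k, F k := Finset.sum_le_univ_sum_of_nonneg hF0
        _ = 1 := by
          rw [hF, ← Finset.sum_div, Finset.sum_comm]
          simp [hn'.ne']
    have hJpos : (0 : ℝ) < J.card := by linarith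
    have hlarge : ∀ k ∈ J, 1 - F k < (J.card : ℝ) / 7 * F k := by
      intro k hk
      have hk' := (hJmem k).mp hk
      by_contra hcon
      have := (hjump k hk'.1 hk'.2.2).2 ((J.card : ℝ) / 7) (by positivity) (not_lt.mp hcon)
      linarith
    -- Each jump bin satisfies `1 < (s/7 + 1) F k`; summing gives `s ≤ s/7 + 1`, hence `s < 2`.
    have hcard : J.card = 1 := by
      have h1 : (J.card : ℝ) ≤ ((J.card : ℝ) / 7 + 1) * 1 := by
        calc (J.card : ℝ) = ∑ k ∈ J, (1 : ℝ) := by simp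
          _ ≤ ∑ k ∈ J, ((J.card : ℝ) / 7 + 1) * F k :=
            Finset.sum_le_sum fun k hk => by linarith [hlarge k hk]
          _ = ((J.card : ℝ) / 7 + 1) * ∑ k ∈ J, F k := by rw [Finset.mul_sum]
          _ ≤ _ := by gcongr
      have h2 : (J.card : ℝ) < 2 := by linarith
      have h3 : J.card < 2 := by exact_mod_cast h2
      have h4 : 0 < J.card := by exact_mod_cast hJpos
      omega
    obtain ⟨k, hk⟩ := Finset.card_eq_one.mp hcard
    have hkJ : k ∈ J := by rw [hk]; simp
    have hlk := hlarge k hkJ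
    rw [hcard] at hlk
    have hk' := (hJmem k).mp hkJ
    have hsq := sum_sq_binAvg_le hn hf hc h0 hk₀ hk (hjump k hk'.1 hk'.2.2).1
    refine ⟨0, by simp, ?_⟩
    have htv : tvOn w 0 (jumpIdx D) = 0 := by simp [tvOn]
    have hpy := sum_sq_sub_eq (c := c) (t := t) (f := f) 0
    simp only [Pi.zero_apply, sub_zero] at hpy ⊢
    rw [htv, mul_zero, add_zero, hpy]
    have hrest : n - (∑ i, if c i = k then (1 : ℝ) else 0) ≤ n / 8 := by
      have : F k * n = ∑ i, if c i = k then (1 : ℝ) else 0 := by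
        rw [hF]; field_simp
      rw [← this]
      push_cast at hlk
      nlinarith
    have h1 : (∑ i, (f (t i) - binAvg c t f (c i)) ^ 2 + ∑ i, binAvg c t f (c i) ^ 2) / n ≤
        3 * (L : ℝ) ^ 2 / r ^ 2 := by
      rw [div_le_iff₀ hn']
      have h2 : ∑ i, binAvg c t f (c i) ^ 2 ≤ n / 8 * (2 * L / D) ^ 2 :=
        hsq.trans (by gcongr)
      -- Within-bin error `1/4` plus mean square of the averages `1/2`, in units of `n L² / D²`;
      -- since `1/D² ≤ 4/r²`, the total is exactly the constant `3`.
      have h3 : n * ((L : ℝ) ^ 2 / (4 * D ^ 2)) + n / 8 * (2 * L / D) ^ 2 =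
          3 / 4 * (L : ℝ) ^ 2 * n * (1 / (D : ℝ) ^ 2) := by
        field_simp; ring
      have h4 := mul_le_mul_of_nonneg_left hD2 (show 0 ≤ 3 / 4 * (L : ℝ) ^ 2 * n by positivity)
      calc _ ≤ _ := add_le_add hwithin h2
        _ = _ := h3
        _ ≤ _ := h4
        _ = _ := by ring
    calc _ ≤ N * (3 * (L : ℝ) ^ 2 / r ^ 2) := by gcongr
      _ = (3 * (L : ℝ) ^ 2 * N + 0) / r ^ 2 := by ring
      _ ≤ _ := by gcongr; positivity

/-! ### Assembling the blocks. -/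

section Main

variable {n p D : ℕ} {x : Fin n → Fin p → ℝ} {b : Fin n → Fin p → Fin D}

lemma weight_nonneg (x : Fin n → Fin p → ℝ) (σ A : ℝ) (j : Fin p) (k : Fin D) :
    0 ≤ weight D x σ A j k := Real.sqrt_nonneg _

lemma log_card_nonneg (p D : ℕ) : 0 ≤ Real.log ((p : ℝ) * D) := by
  exact_mod_cast Real.log_natCast_nonneg (p * D)

lemma weight_eq (hb : ∀ i j k, x i j ∈ bin D k ↔ b i j = k) (σ : ℝ) {A : ℝ} (hA : 0 < A)
    (j : Fin p) (k : Fin D) :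
    weight D x σ A j k = √(2 * (σ ^ 2 * (A + Real.log ((p : ℝ) * D))) / n) *
      √((∑ i, if k ≤ b i j then (1 : ℝ) else 0) / n) := by
  have := log_card_nonneg p D
  rw [weight, tailProp_eq hb, Real.sqrt_mul (by positivity), mul_assoc]

lemma weight_anti (hb : ∀ i j k, x i j ∈ bin D k ↔ b i j = k) (σ : ℝ) {A : ℝ} (hA : 0 < A)
    (j : Fin p) {k l : Fin D} (h : k ≤ l) : weight D x σ A j l ≤ weight D x σ A j k := by
  have := log_card_nonneg p D
  unfold weight
  have := tailProp_anti hb j h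
  gcongr

lemma thetaStar_eq (hb : ∀ i j k, x i j ∈ bin D k ↔ b i j = k) {S : Finset (Fin p)}
    (m : Fin p → ℝ → ℝ) {j : Fin p} (hj : j ∈ S) :
    thetaStar D x S m j = binAvg (fun i => b i j) (fun i => x i j) (m j) := by
  classical
  funext k
  have : ∀ i, oneHot D k (x i j) = if b i j = k then 1 else 0 := by
    intro i; simp [oneHot, Set.indicator, hb]
  simp only [thetaStar, if_pos hj, binAvg, this]

/-- Cauchy–Schwarz over the active features; this is the source of the extra factor `S.card` in
front of `L²`. -/
lemma empNormSq_additive_sub_le (hb : ∀ i j k, x i j ∈ bin D k ↔ b i j = k)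
    (S : Finset (Fin p)) (m : Fin p → ℝ → ℝ) {h : Fin p → Fin D → ℝ}
    (hh : ∀ j ∉ S, h j = 0) :
    empNormSq x (fun z => mFun h z - additive S m z) ≤
      ∑ j ∈ S, (S.card : ℝ) * ((∑ i, (m j (x i j) - h j (b i j)) ^ 2) / n) := by
  have h1 : ∀ i, (mFun h (x i) - additive S m (x i)) ^ 2 ≤
      S.card * ∑ j ∈ S, (m j (x i j) - h j (b i j)) ^ 2 := by
    intro i
    have : mFun h (x i) = ∑ j ∈ S, h j (b i j) := by
      rw [mFun_eq hb]
      symm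
      exact Finset.sum_subset (Finset.subset_univ S) fun j _ hj => by simp [hh j hj]
    rw [this, additive, ← Finset.sum_sub_distrib]
    refine sq_sum_le_card_mul_sum_sq.trans (le_of_eq ?_)
    congr 1
    exact Finset.sum_congr rfl fun j _ => by ring
  unfold empNormSq
  calc _ ≤ 1 / (n : ℝ) * ∑ i, (S.card : ℝ) * ∑ j ∈ S, (m j (x i j) - h j (b i j)) ^ 2 := by
        gcongr with i; exact h1 i
    _ = _ := by
        rw [← Finset.mul_sum, Finset.sum_comm, ← Finset.mul_sum, ← Finset.sum_div]
        ring

/-- Deterministic oracle inequality, on the event where the weights dominate the noise. -/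
lemma oracle_inequality (hn : 0 < n) (hb : ∀ i j k, x i j ∈ bin D k ↔ b i j = k)
    {r : ℝ} (hDr : (D : ℝ) ≤ r) (hrD : r ≤ 2 * D) (hrn : r ^ 3 = n)
    {S : Finset (Fin p)} {m : Fin p → ℝ → ℝ} {L : ℝ≥0}
    (hLip : ∀ j ∈ S, LipschitzWith L (m j)) (hcentred : ∀ j, ∑ i, m j (x i j) = 0)
    {σ A : ℝ} (hA : 0 < A) {w : Fin p → Fin D → ℝ} (hw : w = weight D x σ A)
    {θs : Fin p → Fin D → ℝ} (hθs : θs = thetaStar D x S m)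
    (hκpos : 0 < kappa x w (jumpSet θs)) {y : Fin n → ℝ}
    (hnoise : ∀ j, ∀ k, |tailNoise b (fun i => y i - additive S m (x i)) j k| ≤ weight D x σ A j k)
    {θ : Fin p → Fin D → ℝ} (hθ : IsBinarsityEstimator x w y θ) :
    empNormSq x (fun z => mFun θ z - additive S m z) ≤
      (3 * (L : ℝ) ^ 2 * S.card + 5120 * (σ ^ 2 * (A + Real.log ((p : ℝ) * D))) *
        ((kappa x w (jumpSet θs) ^ 2)⁻¹).toReal) * (S.card / r ^ 2) := by
  have hlog := log_card_nonneg p D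
  set V := σ ^ 2 * (A + Real.log ((p : ℝ) * D)) with hVdef
  have hV : 0 ≤ V := by positivity
  set κ := kappa x w (jumpSet θs) with hκdef
  set κi := ((κ ^ 2)⁻¹).toReal with hκi
  have hw0 : ∀ j k, 0 ≤ w j k := fun j k => by rw [hw]; exact weight_nonneg x σ A j k
  have hanti : ∀ j, ∀ k l, k ≤ l → w j l ≤ w j k := fun j k l h => by
    rw [hw]; exact weight_anti hb σ hA j h
  have hcomp : ∀ j, ∃ h : Fin D → ℝ, ∑ i, h (b i j) = 0 ∧ (j ∉ S → h = 0) ∧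
      (j ∈ S → (S.card : ℝ) * ((∑ i, (m j (x i j) - h (b i j)) ^ 2) / n) +
        4 * tvOn (w j) h (jumpIdx D) ≤
        (3 * (L : ℝ) ^ 2 * S.card + 5120 * V * κi) / r ^ 2) := by
    intro j
    by_cases hj : j ∈ S
    · have hN : (1 : ℝ) ≤ S.card := by exact_mod_cast Finset.card_pos.mpr ⟨j, hj⟩
      obtain ⟨h, h1, h2⟩ := exists_comparator (c := fun i => b i j)
        (t := fun i => x i j) (w := w j) (κi := κi) hn (hLip j hj) (fun i => (hb i j _).mpr rfl)
        (hcentred j) hDr hrD hrn hV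
        ENNReal.toReal_nonneg hN (fun k => by rw [hw]; exact weight_eq hb σ hA j k)
        (by
          intro k hk hne
          rw [← thetaStar_eq hb m hj, ← hθs] at hne
          have hkJ : k ∈ jumpSet θs j := Finset.mem_filter.mpr ⟨hk, hne⟩
          have hF : (∑ i, if b i j = k then (1 : ℝ) else 0) / n = binProp x j k := by
            rw [sum_bin_eq hn hb]
            field_simp
          refine ⟨?_, fun s hs hle => ?_⟩
          · have hpos := binProp_pos_of_kappa_pos hn hb hw0 hanti hκpos hkJ hk
            rw [← hF] at hpos
            by_contra hcon
            push Not at hcon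
            simp [hcon] at hpos
          · rw [hF] at hle
            exact le_inv_kappa_sq hn hb hw0 hanti hκpos hkJ hk hs hle)
      exact ⟨h, h1, fun h' => absurd hj h', fun _ => h2⟩
    · exact ⟨0, by simp, fun _ => rfl, fun h' => absurd h' hj⟩
  choose h hcent hout hin using hcomp
  have hslow := slow_rate hn hb hw0 (additive S m)
    (fun j k => by rw [hw]; exact hnoise j k) hθ
    (fun j => (blockCentered_iff hb j (h j)).mpr (hcent j))
  have happrox := empNormSq_additive_sub_le hb S m hout
  have htv : ∑ j, tvOn (w j) (h j) (jumpIdx D) =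
      ∑ j ∈ S, tvOn (w j) (h j) (jumpIdx D) := by
    symm
    refine Finset.sum_subset (Finset.subset_univ S) fun j _ hj => ?_
    simp [tvOn, hout j hj]
  calc _ ≤ ∑ j ∈ S, ((S.card : ℝ) * ((∑ i, (m j (x i j) - h j (b i j)) ^ 2) / n) +
          4 * tvOn (w j) (h j) (jumpIdx D)) := by
        rw [htv, Finset.mul_sum] at hslow
        rw [Finset.sum_add_distrib]
        linarith
    _ ≤ ∑ j ∈ S, (3 * (L : ℝ) ^ 2 * S.card + 5120 * V * κi) / r ^ 2 :=
        Finset.sum_le_sum fun j hj => hin j hj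
    _ = _ := by rw [Finset.sum_const, nsmul_eq_mul]; ring

end Main

end Binarsity

theorem theorem2 {Ω : Type*} [MeasurableSpace Ω] (μ : Measure Ω) [IsProbabilityMeasure μ]
    (n p : ℕ) (hn : 0 < n)
    -- the design, with features in the unit interval
    (x : Fin n → Fin p → ℝ) (hx : ∀ i j, x i j ∈ Set.Icc (0 : ℝ) 1)
    -- the sparse additive regression function, with components that are centred on the sample
    (S : Finset (Fin p)) (m : Fin p → ℝ → ℝ) (L : ℝ≥0)
    (hLip : ∀ j ∈ S, LipschitzWith L (m j))
    (hcentred : ∀ j, ∑ i, m j (x i j) = 0)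
    -- independent Gaussian labels
    (σ : ℝ≥0) (hσ : 0 < σ) (Y : Fin n → Ω → ℝ)
    (hlaw : ∀ i, HasLaw (Y i) (gaussianReal (Binarsity.additive S m (x i)) (σ ^ 2)) μ)
    (hindep : iIndepFun Y μ)
    (A : ℝ) (hA : 0 < A)
    -- the weights and the reference coefficients
    (w : Fin p → Fin (Binarsity.numBins n) → ℝ)
    (hw : w = Binarsity.weight (Binarsity.numBins n) x σ A)
    (θs : Fin p → Fin (Binarsity.numBins n) → ℝ)
    (hθs : θs = Binarsity.thetaStar (Binarsity.numBins n) x S m)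
    (hRE : Binarsity.RECondition x w (∑ j, (Binarsity.jumpSet θs j).card)) :
    ∃ E : Set Ω, MeasurableSet E ∧ ENNReal.ofReal (1 - 2 * Real.exp (-A)) ≤ μ E ∧
      ∀ ω ∈ E, ∀ θ : Fin p → Fin (Binarsity.numBins n) → ℝ,
        Binarsity.IsBinarsityEstimator x w (fun i => Y i ω) θ →
        Binarsity.empNormSq x (fun z => Binarsity.mFun θ z - Binarsity.additive S m z) ≤
          (3 * (L : ℝ) ^ 2 * (S.card : ℝ) +
            5120 * Binarsity.maxComponent x m * (σ : ℝ) ^ 2 *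
              (A + Real.log ((p : ℝ) * (n : ℝ) ^ (1 / 3 : ℝ) * Binarsity.maxComponent x m)) *
              ((Binarsity.kappa x w (Binarsity.jumpSet θs) ^ 2)⁻¹).toReal) *
            ((S.card : ℝ) / (n : ℝ) ^ (2 / 3 : ℝ)) := by
  have hDpos : 0 < Binarsity.numBins n := Binarsity.numBins_pos hn
  choose b hbmem using fun i j => Binarsity.exists_bin hDpos (hx i j)
  have hb : ∀ i j k, x i j ∈ Binarsity.bin (Binarsity.numBins n) k ↔ b i j = k := fun i j k =>
    ⟨fun h => Binarsity.bin_unique (hbmem i j) h, fun h => h ▸ hbmem i j⟩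
  obtain ⟨E, hE, hμE, hnoise⟩ := Binarsity.exists_noise_event hn hb hσ hlaw hindep hA
  refine ⟨E, hE, hμE, fun ω hω θ hθ => ?_⟩
  have hrn : ((n : ℝ) ^ (1 / 3 : ℝ)) ^ 3 = n := by
    rw [← Real.rpow_natCast, ← Real.rpow_mul (Nat.cast_nonneg n)]; norm_num
  have hr2 : (n : ℝ) ^ (2 / 3 : ℝ) = ((n : ℝ) ^ (1 / 3 : ℝ)) ^ 2 := by
    rw [← Real.rpow_natCast, ← Real.rpow_mul (Nat.cast_nonneg n)]; norm_num
  have hκpos : 0 < Binarsity.kappa x w (Binarsity.jumpSet θs) :=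
    hRE _ (fun j => by unfold Binarsity.jumpSet; exact Finset.filter_subset _ _) le_rfl
  have hsum := Binarsity.oracle_inequality hn hb (Binarsity.numBins_le n)
    (Binarsity.rpow_third_le hn) hrn hLip hcentred hA hw hθs hκpos (hnoise ω hω) hθ
  have hDr := Binarsity.numBins_le n
  generalize ((Binarsity.kappa x w (Binarsity.jumpSet θs) ^ 2)⁻¹) = κi at hsum ⊢
  generalize (n : ℝ) ^ (1 / 3 : ℝ) = r at hsum hDr hr2 ⊢
  rw [hr2]
  -- With no active feature both bounds are `0`. Otherwise `p > 0`, so the logarithms compare, and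
  -- `M ≥ 1` only weakens the bound.
  rcases S.eq_empty_or_nonempty with hS | ⟨j, -⟩
  · rw [hS] at hsum ⊢
    simpa using hsum
  · refine hsum.trans (mul_le_mul_of_nonneg_right ?_ (by positivity))
    set M := Binarsity.maxComponent x m with hM
    have hM1 : 1 ≤ M := le_max_left _ _
    have hp : (0 : ℝ) < p := by exact_mod_cast j.pos
    have hD' : (0 : ℝ) < Binarsity.numBins n := by exact_mod_cast hDpos
    have hlog_le : Real.log ((p : ℝ) * Binarsity.numBins n) ≤ Real.log ((p : ℝ) * r * M) := by
      apply Real.log_le_log (by positivity)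
      calc (p : ℝ) * Binarsity.numBins n ≤ p * r := by gcongr
        _ ≤ p * r * M := le_mul_of_one_le_right (mul_nonneg hp.le (hD'.le.trans hDr)) hM1
    have hVle : (σ : ℝ) ^ 2 * (A + Real.log ((p : ℝ) * Binarsity.numBins n)) ≤
        M * ((σ : ℝ) ^ 2 * (A + Real.log ((p : ℝ) * r * M))) := by
      calc _ ≤ (σ : ℝ) ^ 2 * (A + Real.log ((p : ℝ) * r * M)) := by gcongr
        _ ≤ _ := le_mul_of_one_le_left
            (mul_nonneg (sq_nonneg _)
              (by linarith [Binarsity.log_card_nonneg p (Binarsity.numBins n)])) hM1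
    have := mul_le_mul_of_nonneg_right hVle (ENNReal.toReal_nonneg (a := κi))
    linarith
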